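/- **Setting.** For $\alpha\in(0,1]$, $R>0$, $\underline\sigma^2>0$ let $\mathcal S(\alpha,R,\underline\sigma^2)$ be the set of functions $\sigma^2:[0,1]\to\mathbb R$ with $\|\sigma^2\|_\infty+\sup_{x\ne y}|\sigma^2(x)-\sigma^2(y)|/|x-y|^\alpha\le R$ and $\min_{t\in[0,1]}\sigma^2(t)\ge\underline\sigma^2$. Let $B,W$ be independent standard Brownian motions. For $\varepsilon>0$ let $\mathcal E_1=\mathcal E_1(\varepsilon,\alpha,R,\underline\sigma^2)$ be the statistical experiment of observing $$dY_t=X_t\,dt+\varepsilon\,dW_t,\quad t\in[0,1],\qquad X_t=\int_0^t\sigma(s)\,dB_s,$$ with unknown parameter $\sigma^2\in\mathcal S(\alpha,R,\underline\sigma^2)$; for $h>0$ with $h^{-1}\in\mathbb N$ let $\mathcal E_2=\mathcal E_2(\varepsilon,h,\alpha,R,\underline\sigma^2)$ be the experiment, with the same parameter set, of observing $$dY_t=X^h_t\,dt+\varepsilon\,dW_t,\quad t\in[0,1],\qquad X^h_t=\int_0^t\sigma(\lfloor s\rfloor_h)\,dB_s,\qquad \lfloor s\rfloor_h:=\lfloor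 s/h\rfloor h.$$ Here observing $Y$ means observing the family $Y_f=\int_0^1 f\,dY$, $f\in L^2([0,1])$, so that the laws live on $\mathbb R^{L^2([0,1])}$ with the product $\sigma$-algebra. For experiments $\mathcal E=(P_\theta)_{\theta\in\Theta}$ and $\mathcal F=(Q_\theta)_{\theta\in\Theta}$ let $\delta(\mathcal E,\mathcal F)=\inf_M\sup_\theta\|MP_\theta-Q_\theta\|_{\mathrm{TV}}$, the infimum being over Markov kernels $M$ between the sample spaces and $\|P-Q\|_{\mathrm{TV}}=\sup_A|P(A)-Q(A)|$, and let $\Delta(\mathcal E,\mathcal F)=\max(\delta(\mathcal E,\mathcal F),\delta(\mathcal F,\mathcal E))$ be the Le Cam distance. **Proposition.** Let $\alpha\in(1/2,1]$, $R>0$ and $\underline\sigma^2>0$. If $\varepsilon\to0$ and $h^{-1}\in\mathbb N$ with $h^\alpha=o(\varepsilon^{1/2})$, then $\mathcal E_1$ and $\mathcal E_2$ are asymptotically equivalent, that is, $\Delta(\mathcal E_1,\mathcal E_2)\to0$. More precisely, there is a universal constant $C>0$ such that for all such $\alpha,R,\underline\sigma^2$, all $\varepsilon>0$ and all $h>0$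 with $h^{-1}\in\mathbb N$ $$\Delta\bigl(\mathcal E_1(\varepsilon,\alpha,R,\underline\sigma^2),\mathcal E_2(\varepsilon,h,\alpha,R,\underline\sigma^2)\bigr)\le C\,R\,\underline\sigma^{-3/2}\,h^\alpha\,\varepsilon^{-1/2},\qquad \underline\sigma=\sqrt{\underline\sigma^2}.$$ -/

import Mathlib

open MeasureTheory ProbabilityTheory Filter Topology Asymptotics
open scoped NNReal ENNReal

noncomputable section

namespace LeCam

/-! ### Statistical experiments and the Le Cam distance -/

/-- A statistical experiment `(𝒳, ℱ, (P_θ)_{θ ∈ Θ})`. -/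
structure Experiment (Θ : Type*) where
  /-- the sample space -/
  space : Type*
  /-- its σ-algebra -/
  [meas : MeasurableSpace space]
  /-- the family of laws -/
  law : Θ → Measure space
  /-- every law is a probability measure -/
  isProb : ∀ θ, IsProbabilityMeasure (law θ)

attribute [instance] Experiment.meas

/-- Total variation distance `sup_A |μ(A) - ν(A)|` of two probability measures. -/
def tvDist {𝒳 : Type*} [MeasurableSpace 𝒳] (μ ν : Measure 𝒳) : ℝ≥0∞ :=
  ⨆ (A : Set 𝒳) (_ : MeasurableSet A), ENNReal.ofReal |μ.real A - ν.real A|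

/-- The deficiency `δ(E, F) = inf_M sup_θ ‖M P_θ - Q_θ‖_TV`, the infimum being over all Markov
kernels `M` from the sample space of `E` to that of `F`. -/
def deficiency {Θ : Type*} (E F : Experiment Θ) : ℝ≥0∞ :=
  ⨅ (M : Kernel E.space F.space) (_ : IsMarkovKernel M), ⨆ θ, tvDist (M ∘ₘ E.law θ) (F.law θ)

/-- The Le Cam distance `Δ(E, F) = max (δ(E, F), δ(F, E))`. -/
def leCamDist {Θ : Type*} (E F : Experiment Θ) : ℝ≥0∞ :=
  max (deficiency E F) (deficiency F E)

/-- Asymptotic equivalence along a filter: the Le Cam distance tends to zero. -/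
def AsymptoticallyEquivalent {ι Θ : Type*} (l : Filter ι) (E F : ι → Experiment Θ) : Prop :=
  Tendsto (fun i => leCamDist (E i) (F i)) l (𝓝 0)

end LeCam

namespace Volatility

open LeCam

/-! ### The class of volatility functions -/

/-- The Hölder norm `‖f‖_∞ + sup_{x ≠ y} |f x - f y| / |x - y| ^ α` of `f : [0,1] → ℝ`
(with values in `[0, ∞]`). -/
def holderNorm (α : ℝ) (f : unitInterval → ℝ) : ℝ≥0∞ :=
  (⨆ x, ENNReal.ofReal |f x|) +
    ⨆ (x : unitInterval) (y : unitInterval) (_ : x ≠ y), ENNReal.ofReal (|f x - f y| / |(x : ℝ) - y| ^ α)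

/-- The class `𝒮(α, R, b)` of all `v = σ² : [0,1] → ℝ` in the Hölder ball of radius `R` with
`min v ≥ b`; here `b` is the lower bound of the squared volatility. -/
def volClass (α R b : ℝ) : Set (unitInterval → ℝ) :=
  {v | holderNorm α v ≤ ENNReal.ofReal R ∧ ∀ t, b ≤ v t}

/-- `⌊s⌋_h = ⌊s / h⌋ h`. For `0 < h` and `s ∈ [0,1]` this number lies in `[0,1]` and the
projection onto `[0,1]` does nothing. -/
def blockFloor (h : ℝ) (s : unitInterval) : unitInterval :=
  Set.projIcc 0 1 zero_le_one ((⌊(s : ℝ) / h⌋ : ℝ) * h)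

/-- The volatility `σ = √(σ²)`. -/
def vol (v : unitInterval → ℝ) (s : unitInterval) : ℝ := √(v s)

/-- The piecewise constant volatility `s ↦ σ(⌊s⌋_h)`. -/
def blockVol (h : ℝ) (v : unitInterval → ℝ) (s : unitInterval) : ℝ := vol v (blockFloor h s)

lemma coe_blockFloor {h : ℝ} (hh : 0 < h) (s : unitInterval) :
    (blockFloor h s : ℝ) = (⌊(s : ℝ) / h⌋ : ℝ) * h := by
  have h0 : (0 : ℝ) ≤ (⌊(s : ℝ) / h⌋ : ℝ) * h :=
    mul_nonneg (by exact_mod_cast Int.floor_nonneg.2 (div_nonneg s.2.1 hh.le)) hh.le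
  have h1 : (⌊(s : ℝ) / h⌋ : ℝ) * h ≤ 1 :=
    (mul_le_mul_of_nonneg_right (Int.floor_le _) hh.le).trans
      (by rw [div_mul_cancel₀ _ hh.ne']; exact s.2.2)
  simp [blockFloor, Set.coe_projIcc, h0, h1]

lemma measurable_blockFloor (h : ℝ) : Measurable (blockFloor h) := by
  refine continuous_projIcc.measurable.comp (Measurable.mul_const ?_ _)
  exact (measurable_from_top (f := fun n : ℤ => (n : ℝ))).comp
    (Int.measurable_floor.comp (measurable_subtype_coe.div_const h))

lemma abs_le_of_mem_volClass {α R b : ℝ} (hR : 0 ≤ R) {v : unitInterval → ℝ} (hv : v ∈ volClass α R b)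
    (t : unitInterval) : |v t| ≤ R :=
  (ENNReal.ofReal_le_ofReal_iff hR).1
    ((le_iSup (fun x => ENNReal.ofReal |v x|) t).trans (le_self_add.trans hv.1))

lemma continuous_of_mem_volClass {α R b : ℝ} (hα : 0 < α) (hR : 0 ≤ R) {v : unitInterval → ℝ}
    (hv : v ∈ volClass α R b) : Continuous v := by
  have key : ∀ x y : unitInterval, |v x - v y| ≤ R * |(x : ℝ) - y| ^ α := by
    intro x y
    rcases eq_or_ne x y with rfl | hxy
    · simp [Real.zero_rpow hα.ne']
    have h1 : ENNReal.ofReal (|v x - v y| / |(x : ℝ) - y| ^ α) ≤ ENNReal.ofReal R :=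
      (le_iSup₂_of_le (f := fun x y : unitInterval => ⨆ (_ : x ≠ y),
        ENNReal.ofReal (|v x - v y| / |(x : ℝ) - y| ^ α)) x y
          (le_iSup_of_le hxy le_rfl)).trans (le_add_self.trans hv.1)
    have hpos : 0 < |(x : ℝ) - y| ^ α :=
      Real.rpow_pos_of_pos (abs_pos.2 (sub_ne_zero.2 fun e => hxy (Subtype.ext e))) _
    exact (div_le_iff₀ hpos).1 ((ENNReal.ofReal_le_ofReal_iff hR).1 h1)
  rw [continuous_iff_continuousAt]
  intro y
  rw [ContinuousAt, tendsto_iff_dist_tendsto_zero]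
  refine squeeze_zero (fun _ => dist_nonneg) (fun x => (Real.dist_eq _ _).trans_le (key x y)) ?_
  have hc : Continuous fun x : unitInterval => R * |(x : ℝ) - y| ^ α :=
    continuous_const.mul ((by fun_prop : Continuous fun x : unitInterval => |(x : ℝ) - y|).rpow_const
      fun _ => Or.inr hα.le)
  simpa [Real.zero_rpow hα.ne'] using hc.tendsto y

lemma memLp_vol {α R b : ℝ} (hα : 0 < α) (hR : 0 ≤ R) {v : unitInterval → ℝ} (hv : v ∈ volClass α R b) :
    MemLp (vol v) 2 (volume : Measure unitInterval) := by
  refine MemLp.of_bound ?_ (√R) (ae_of_all _ fun s => ?_)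
  · exact (Real.continuous_sqrt.comp
      (continuous_of_mem_volClass hα hR hv)).measurable.aestronglyMeasurable
  · rw [vol, Real.norm_of_nonneg (Real.sqrt_nonneg _)]
    exact Real.sqrt_le_sqrt ((le_abs_self _).trans (abs_le_of_mem_volClass hR hv s))

lemma memLp_blockVol {α R b : ℝ} (hα : 0 < α) (hR : 0 ≤ R) (h : ℝ) {v : unitInterval → ℝ}
    (hv : v ∈ volClass α R b) : MemLp (blockVol h v) 2 (volume : Measure unitInterval) := by
  refine MemLp.of_bound ?_ (√R) (ae_of_all _ fun s => ?_)
  · exact ((Real.continuous_sqrt.comp (continuous_of_mem_volClass hα hR hv)).measurable.comp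
      (measurable_blockFloor h)).aestronglyMeasurable
  · rw [blockVol, vol, Real.norm_of_nonneg (Real.sqrt_nonneg _)]
    exact Real.sqrt_le_sqrt ((le_abs_self _).trans (abs_le_of_mem_volClass hR hv _))

/-! ### Wiener integrals and the white noise model -/

/-- `L²([0,1])`. -/
abbrev L2I : Type := Lp ℝ 2 (volume : Measure unitInterval)

variable {Ω : Type*} [MeasurableSpace Ω] {P : Measure Ω} {B W : ℝ≥0 → Ω → ℝ}

lemma memLp_brownian (hB : IsBrownianReal B P) (t : ℝ≥0) : MemLp (B t) 2 P :=
  (hB.isGaussianProcess.hasGaussianLaw_eval t).memLp_two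

/-- The step functions `∑ c_t 1_{[0,t]}`, as elements of `L²([0,1])`. -/
def stepFun : (unitInterval →₀ ℝ) →ₗ[ℝ] L2I :=
  Finsupp.linearCombination ℝ fun t : unitInterval =>
    indicatorConstLp 2 (measurableSet_Iic (a := t)) (measure_ne_top _ _) (1 : ℝ)

/-- The elementary integrals `∑ c_t B_t`, as elements of `L²(P)`. -/
def elemIntegral (hB : IsBrownianReal B P) : (unitInterval →₀ ℝ) →ₗ[ℝ] Lp ℝ 2 P :=
  Finsupp.linearCombination ℝ fun t : unitInterval => (memLp_brownian hB (unitInterval.toNNReal t)).toLp _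

/-- The Wiener integral `f ↦ ∫₀¹ f(t) dB_t`: the continuous linear extension to `L²([0,1])` of
the isometry `∑ c_t 1_{[0,t]} ↦ ∑ c_t B_t`. -/
def wienerIntegral (hB : IsBrownianReal B P) : L2I →L[ℝ] Lp ℝ 2 P :=
  (elemIntegral hB).extendOfNorm stepFun

/-! The Wiener integral extends the elementary integral and is an isometry. -/

lemma denseRange_stepFun : DenseRange stepFun := by
  have hr : Set.range stepFun = ((Submodule.span ℝ (Set.range fun t : unitInterval =>
    indicatorConstLp 2 (μ := (volume : Measure unitInterval)) (measurableSet_Iic (a := t)) (measure_ne_top _ _) (1 : ℝ))) : Set L2I) := by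
    rw [← Finsupp.range_linearCombination]; rfl
  rw [DenseRange, hr, Submodule.dense_iff_topologicalClosure_eq_top,
    Submodule.topologicalClosure_eq_top_iff, Submodule.eq_bot_iff]
  intro f hf
  have h0 : ∀ t : unitInterval, ∫ x in Set.Iic t, f x = 0 := by
    intro t
    have := (Submodule.mem_orthogonal _ _).1 hf _ (Submodule.subset_span ⟨t, rfl⟩)
    rw [L2.inner_indicatorConstLp_one] at this
    exact this
  have hint : Integrable (f : unitInterval → ℝ) volume :=
    (Lp.memLp f).integrable (by norm_num)
  have : (f : unitInterval → ℝ) =ᵐ[volume] 0 := by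
    apply hint.ae_eq_zero_of_forall_setIntegral_eq_zero
    intro s hs _
    have hgen := borel_eq_generateFrom_Iic unitInterval
    induction s, hs using MeasurableSpace.induction_on_inter ((BorelSpace.measurable_eq).trans hgen) (isPiSystem_Iic) with
    | empty => simp
    | basic u hu => obtain ⟨t, rfl⟩ := hu; exact h0 t
    | compl u hu ih =>
      have h2 : ∫ x, f x = 0 := by
        have h1 : Set.Iic (1 : unitInterval) = Set.univ :=
          Set.eq_univ_of_forall fun x => unitInterval.le_one'
        simpa [h1] using h0 1
      have h3 := integral_add_compl hu hint
      rw [ih (measure_lt_top _ _), h2, zero_add] at h3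
      exact h3
    | iUnion u hd hm ih =>
      rw [integral_iUnion hm hd hint.integrableOn]
      simp [fun i => ih i (measure_lt_top _ _)]
  exact (Lp.eq_zero_iff_ae_eq_zero).2 this

lemma norm_elemIntegral (hB : IsBrownianReal B P) (c : unitInterval →₀ ℝ) :
    ‖elemIntegral hB c‖ = ‖stepFun c‖ := by
  have key : ∀ s t : unitInterval,
     inner ℝ ((memLp_brownian hB (unitInterval.toNNReal s)).toLp _) ((memLp_brownian hB (unitInterval.toNNReal t)).toLp _)
     = inner ℝ (indicatorConstLp 2 (μ := (volume : Measure unitInterval)) (measurableSet_Iic (a := s)) (measure_ne_top _ _) (1 : ℝ)) (indicatorConstLp 2 (μ := (volume : Measure unitInterval)) (measurableSet_Iic (a := t)) (measure_ne_top _ _) (1 : ℝ)) := by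
    intro s t
    have := hB.isGaussianProcess.isProbabilityMeasure
    have hc := hB.covariance_eval (unitInterval.toNNReal s) (unitInterval.toNNReal t)
    rw [covariance_eq_sub (memLp_brownian hB _) (memLp_brownian hB _), hB.integral_eval, zero_mul, sub_zero] at hc
    rw [L2.inner_indicatorConstLp_one, L2.inner_def]
    trans (((min (unitInterval.toNNReal s) (unitInterval.toNNReal t) : ℝ≥0)) : ℝ)
    · rw [← hc]
      apply integral_congr_ae
      filter_upwards [(memLp_brownian hB (unitInterval.toNNReal s)).coeFn_toLp, (memLp_brownian hB (unitInterval.toNNReal t)).coeFn_toLp] with ω h1 h2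
      rw [h1, h2]; simp [mul_comm]
    · rw [setIntegral_congr_ae (g := (Set.Iic t).indicator fun _ => (1:ℝ)) measurableSet_Iic (by
         filter_upwards [indicatorConstLp_coeFn (p := 2) (μ := (volume : Measure unitInterval)) (hs := measurableSet_Iic (a := t)) (hμs := measure_ne_top _ _) (c := (1:ℝ))] with x hx _
         exact hx)]
      rw [setIntegral_indicator measurableSet_Iic, Set.Iic_inter_Iic]
      have hm : (((min (unitInterval.toNNReal s) (unitInterval.toNNReal t) : ℝ≥0)) : ℝ) =
          min (s : ℝ) t := by
        rw [NNReal.coe_min]; rfl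
      rw [hm]
      rcases le_total s t with h | h
      · simp [Measure.real, min_eq_left h, min_eq_left (show (s : ℝ) ≤ t from h), s.2.1]
      · simp [Measure.real, min_eq_right h, min_eq_right (show (t : ℝ) ≤ s from h), t.2.1]
  have : inner ℝ (elemIntegral hB c) (elemIntegral hB c) = inner ℝ (stepFun c) (stepFun c) := by
    simp only [elemIntegral, stepFun, Finsupp.linearCombination_apply, Finsupp.sum, sum_inner, inner_sum, inner_smul_left, inner_smul_right, key]
  rw [real_inner_self_eq_norm_sq, real_inner_self_eq_norm_sq] at this
  exact (pow_left_inj₀ (norm_nonneg _) (norm_nonneg _) two_ne_zero).1 this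

lemma wienerIntegral_stepFun (hB : IsBrownianReal B P) (c : unitInterval →₀ ℝ) :
    wienerIntegral hB (stepFun c) = elemIntegral hB c :=
  LinearMap.extendOfNorm_eq denseRange_stepFun ⟨1, fun x => by rw [norm_elemIntegral, one_mul]⟩ c

lemma norm_wienerIntegral (hB : IsBrownianReal B P) (f : L2I) : ‖wienerIntegral hB f‖ = ‖f‖ := by
  refine denseRange_stepFun.induction_on (p := fun f => ‖wienerIntegral hB f‖ = ‖f‖) f
    (isClosed_eq (by fun_prop) (by fun_prop)) fun c => ?_
  rw [wienerIntegral_stepFun, norm_elemIntegral]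

/-- The signal `X_t = ∫₀ᵗ σ(s) dB_s` for a deterministic `σ ∈ L²([0,1])`. -/
def signal (hB : IsBrownianReal B P) {σ : unitInterval → ℝ} (hσ : MemLp σ 2 (volume : Measure unitInterval)) (t : unitInterval) :
    Lp ℝ 2 P :=
  wienerIntegral hB ((hσ.indicator (measurableSet_Iic (a := t))).toLp _)

lemma integrable_signal (hB : IsBrownianReal B P) {σ : unitInterval → ℝ}
    (hσ : MemLp σ 2 (volume : Measure unitInterval)) (f : L2I) :
    Integrable fun t => f t • signal hB hσ t := by
  have hc : Continuous (signal hB hσ) := by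
    refine (wienerIntegral hB).continuous.comp ?_
    rw [continuous_iff_continuousAt]
    intro t
    rw [ContinuousAt, Lp.tendsto_Lp_iff_tendsto_eLpNorm'']
    have h2 : Tendsto (fun s : unitInterval => ∫⁻ x, ‖(Set.Iic s).indicator σ x - (Set.Iic t).indicator σ x‖ₑ ^ (2:ℝ)) (𝓝 t) (𝓝 (∫⁻ _ : unitInterval, 0)) := by
      refine tendsto_lintegral_filter_of_dominated_convergence' (fun x => ‖σ x‖ₑ ^ (2:ℝ)) ?_ ?_ ?_ ?_
      · refine Eventually.of_forall fun s => ?_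
        exact (((hσ.indicator measurableSet_Iic).1.sub (hσ.indicator measurableSet_Iic).1).enorm).pow_const _
      · refine Eventually.of_forall fun s => ae_of_all _ fun x => ?_
        gcongr
        by_cases h1 : x ∈ Set.Iic s <;> by_cases h2 : x ∈ Set.Iic t <;> simp [h1, h2]
      · have := hσ.2
        exact (lintegral_rpow_enorm_lt_top_of_eLpNorm_lt_top two_ne_zero ENNReal.ofNat_ne_top this).ne
      · have : ∀ᵐ x : unitInterval, x ≠ t := by simp [ae_iff]
        filter_upwards [this] with x hx
        refine tendsto_const_nhds.congr' ?_
        rcases lt_or_gt_of_ne hx with h | h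
        · filter_upwards [lt_mem_nhds h] with s hs
          simp [hs.le, h.le]
        · filter_upwards [gt_mem_nhds h] with s hs
          simp [not_le.2 hs, not_le.2 h]
    simp only [lintegral_zero] at h2
    have h3 := (ENNReal.continuous_rpow_const (y := (1/2:ℝ))).tendsto 0 |>.comp h2
    simp only [one_div, ENNReal.zero_rpow_of_pos (by norm_num : (0:ℝ) < 2⁻¹)] at h3
    refine h3.congr fun s => ?_
    rw [eLpNorm_eq_lintegral_rpow_enorm_toReal two_ne_zero ENNReal.ofNat_ne_top]
    simp
  obtain ⟨K, hK⟩ := (isCompact_range hc).isBounded.exists_norm_le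
  exact ((Lp.memLp f).integrable (by norm_num)).smul_of_top_left (memLp_top_of_bound hc.aestronglyMeasurable K (ae_of_all _ fun t => hK _ ⟨t, rfl⟩))

/-- The observation `Y_f = ∫₀¹ f dY` for `dY_t = X_t dt + ε dW_t`, that is
`Y_f = ∫₀¹ f(t) X_t dt + ε ∫₀¹ f(t) dW_t`; the first integral is that of the continuous curve
`t ↦ X_t` in `L²(P)` against `f(t) dt`. -/
def observation (hB : IsBrownianReal B P) (hW : IsBrownianReal W P) {σ : unitInterval → ℝ}
    (hσ : MemLp σ 2 (volume : Measure unitInterval)) (ε : ℝ) (f : L2I) : Lp ℝ 2 P :=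
  (∫ t : unitInterval, f t • signal hB hσ t) + ε • wienerIntegral hW f

/-- The law on `ℝ^{L²([0,1])}` (with the product σ-algebra) of the `L²([0,1])`-indexed family of
observations `(Y_f)_f`. -/
def observationLaw (hB : IsBrownianReal B P) (hW : IsBrownianReal W P) {σ : unitInterval → ℝ}
    (hσ : MemLp σ 2 (volume : Measure unitInterval)) (ε : ℝ) : Measure (L2I → ℝ) :=
  P.map fun ω f => observation hB hW hσ ε f ω

lemma measurable_observation (hB : IsBrownianReal B P) (hW : IsBrownianReal W P) {σ : unitInterval → ℝ}
    (hσ : MemLp σ 2 (volume : Measure unitInterval)) (ε : ℝ) :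
    Measurable fun ω (f : L2I) => observation hB hW hσ ε f ω :=
  measurable_pi_lambda _ fun _ => (Lp.stronglyMeasurable _).measurable

lemma isProbabilityMeasure_observationLaw (hB : IsBrownianReal B P) (hW : IsBrownianReal W P)
    {σ : unitInterval → ℝ} (hσ : MemLp σ 2 (volume : Measure unitInterval)) (ε : ℝ) :
    IsProbabilityMeasure (observationLaw hB hW hσ ε) := by
  have := hB.isGaussianProcess.isProbabilityMeasure
  exact Measure.isProbabilityMeasure_map (measurable_observation hB hW hσ ε).aemeasurable

/-! ### The two experiments -/

/-- The experiment `ℰ₁(ε, α, R, b)` of observing `dY_t = X_t dt + ε dW_t`, `t ∈ [0,1]`, with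
`X_t = ∫₀ᵗ σ(s) dB_s` and unknown `σ² ∈ 𝒮(α, R, b)`. -/
def experimentOne (hB : IsBrownianReal B P) (hW : IsBrownianReal W P) (ε : ℝ) {α R : ℝ}
    (hα : 0 < α) (hR : 0 < R) (b : ℝ) : Experiment (volClass α R b) where
  space := L2I → ℝ
  law v := observationLaw hB hW (memLp_vol hα hR.le v.2) ε
  isProb v := isProbabilityMeasure_observationLaw hB hW (memLp_vol hα hR.le v.2) ε

/-- The experiment `ℰ₂(ε, h, α, R, b)` of observing `dY_t = X^h_t dt + ε dW_t`, `t ∈ [0,1]`, with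
`X^h_t = ∫₀ᵗ σ(⌊s⌋_h) dB_s` and unknown `σ² ∈ 𝒮(α, R, b)`. -/
def experimentTwo (hB : IsBrownianReal B P) (hW : IsBrownianReal W P) (ε h : ℝ) {α R : ℝ}
    (hα : 0 < α) (hR : 0 < R) (b : ℝ) : Experiment (volClass α R b) where
  space := L2I → ℝ
  law v := observationLaw hB hW (memLp_blockVol hα hR.le h v.2) ε
  isProb v := isProbabilityMeasure_observationLaw hB hW (memLp_blockVol hα hR.le h v.2) ε

/-- An admissible block length: `h > 0` and `h⁻¹ ∈ ℕ`. -/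
def IsBlockLength (h : ℝ) : Prop := 0 < h ∧ ∃ N : ℕ, h⁻¹ = N

end Volatility

end

namespace LeCam

/-! ### Total variation bounds for product Gaussian measures -/

/-! Both experiments live on the same sample space, so the identity kernel bounds both deficiencies
and it is enough to bound, uniformly in the parameter, the total variation distance of two centred
Gaussian laws. Stochastic Fubini turns `∫ f(t) X_t dt` into the Wiener integral of `σ F`, where
`F(s) = ∫ₛ¹ f`. By independence of the two Brownian motions, `Y_f` is then centred Gaussian with
variance `q_σ(f) = ∫ σ² F² + ε² ‖f‖²` (`charVal_obsLinear`).

Total variation is determined by cylinder sets, hence by finitely many observations. On their span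
the quadratic forms of the two volatilities are diagonalised simultaneously by some `eᵢ`
(`exists_orthonormal_orthogonal`), which leaves `N(0, I)` against `N(0, diag m)`. A chi-square
computation bounds their distance by `√(2 ∑ (mᵢ - 1)²)`, and it remains to bound this sum
independently of the dimension.

If the squared volatilities differ by at most `δ`, then `|mᵢ - 1| ≤ δ yᵢ` with `yᵢ = ∫ Fᵢ²`.
Normalisation and `σ² ≥ b` give `yᵢ ≤ 1/b`. The inequality `√b ε F(s)² ≤ q_σ(f)` says that
evaluation of `F` at `s` is a bounded functional; Bessel's inequality gives `∑ Fᵢ(s)² ≤ (√b ε)⁻¹`,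
and integration over `s` gives the same bound for `∑ yᵢ`. Therefore `∑ (mᵢ - 1)² ≤ δ² b⁻¹ (√b ε)⁻¹`.
With `δ = R h^α` from the Hölder condition, the rate `R b^(-3/4) h^α ε^(-1/2)` follows, with
constant `√2`. -/

lemma pi_withDensity_eq {ι : Type*} [Fintype ι] {E : ι → Type*} [∀ i, MeasurableSpace (E i)]
    (Q : ∀ i, Measure (E i)) [∀ i, IsProbabilityMeasure (Q i)] (ρ : ∀ i, E i → ℝ≥0∞)
    (hρ : ∀ i, Measurable (ρ i)) [∀ i, SigmaFinite ((Q i).withDensity (ρ i))] :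
    Measure.pi (fun i => (Q i).withDensity (ρ i)) =
      (Measure.pi Q).withDensity (fun x => ∏ i, ρ i (x i)) := by
  refine Measure.pi_eq fun s hs => ?_
  rw [withDensity_apply _ (MeasurableSet.univ_pi hs), ← lintegral_indicator (MeasurableSet.univ_pi hs)]
  have h1 : (Set.univ.pi s).indicator (fun x : ∀ i, E i => ∏ i, ρ i (x i)) =
      fun x => ∏ i, (s i).indicator (ρ i) (x i) := by
    classical
    funext x
    by_cases hx : x ∈ Set.univ.pi s
    · rw [Set.indicator_of_mem hx]
      exact Finset.prod_congr rfl fun i _ => (Set.indicator_of_mem (hx i trivial) _).symm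
    · rw [Set.indicator_of_notMem hx]
      simp only [Set.mem_univ_pi, not_forall] at hx
      obtain ⟨i, hi⟩ := hx
      exact (Finset.prod_eq_zero (Finset.mem_univ i) (Set.indicator_of_notMem hi _)).symm
  -- Coordinates are independent under the product measure, so the integral of the product
  -- factorises.
  rw [h1, lintegral_prod_eq_prod_lintegral_of_indepFun Finset.univ
    (fun i (x : ∀ i, E i) => (s i).indicator (ρ i) (x i))
    (iIndepFun_pi fun i => ((hρ i).indicator (hs i)).aemeasurable)
    (fun i => ((hρ i).indicator (hs i)).comp (measurable_pi_apply i))]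
  refine Finset.prod_congr rfl fun i _ => ?_
  rw [withDensity_apply _ (hs i), ← lintegral_indicator (hs i)]
  exact (measurePreserving_eval Q i).lintegral_comp ((hρ i).indicator (hs i))

/-- Chi-square bound: the left side is at most the `L¹` norm of `1 - D`, hence at most its `L²`
norm, and `∫ (1 - D)² = ∫ D² - 1` since `D` has integral one. -/
lemma abs_measureReal_withDensity_sub_le {E : Type*} [MeasurableSpace E] (Q : Measure E)
    [IsProbabilityMeasure Q] {D : E → ℝ} (hD : Measurable D) (h0 : ∀ x, 0 ≤ D x)
    (h1 : ∫ x, D x ∂Q = 1) (h2 : Integrable (fun x => D x ^ 2) Q) {A : Set E}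
    (hA : MeasurableSet A) :
    |Q.real A - (Q.withDensity fun x => ENNReal.ofReal (D x)).real A| ≤
      √(∫ x, D x ^ 2 ∂Q - 1) := by
  have hD2 : MemLp D 2 Q := (memLp_two_iff_integrable_sq hD.aestronglyMeasurable).2 h2
  have hDi : Integrable D Q := hD2.integrable (by norm_num)
  have hL : MemLp (fun x => |1 - D x|) 2 Q := ((memLp_const (1 : ℝ)).sub hD2).abs
  have hA' : (Q.withDensity fun x => ENNReal.ofReal (D x)).real A = ∫ x in A, D x ∂Q := by
    rw [Measure.real, withDensity_apply _ hA,
      ← ofReal_integral_eq_lintegral_ofReal hDi.integrableOn (ae_of_all _ h0),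
      ENNReal.toReal_ofReal (integral_nonneg h0)]
  have hle : |Q.real A - (Q.withDensity fun x => ENNReal.ofReal (D x)).real A| ≤
      ∫ x, |1 - D x| ∂Q := by
    rw [hA', show Q.real A = ∫ x in A, (1 : ℝ) ∂Q by simp, ← integral_sub (integrable_const _) hDi.integrableOn]
    refine abs_integral_le_integral_abs.trans ?_
    exact setIntegral_le_integral (hL.integrable (by norm_num)) (ae_of_all _ fun x => abs_nonneg _)
  refine hle.trans (Real.le_sqrt_of_sq_le ?_)
  -- Cauchy–Schwarz in the form of a nonnegative variance of `|1 - D|`.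
  have hv := variance_nonneg (fun x => |1 - D x|) Q
  rw [variance_eq_sub hL, sub_nonneg] at hv
  refine hv.trans_eq ?_
  have h3 : ∀ x, ((fun x => |1 - D x|) ^ 2) x = 1 - 2 * D x + D x ^ 2 := fun x => by
    simp only [Pi.pow_apply, sq_abs]; ring
  simp_rw [h3]
  rw [integral_add (f := fun x => 1 - 2 * D x) ((integrable_const _).sub (hDi.const_mul 2)) h2,
    integral_sub (integrable_const _) (hDi.const_mul 2), integral_const_mul, h1]
  simp; ring

/-- The density of `N(0, m)` with respect to `N(0, 1)`. -/
noncomputable def gaussianRatio (m : ℝ) (x : ℝ) : ℝ := (√m)⁻¹ * Real.exp (-((1 / m - 1) / 2) * x ^ 2)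

lemma measurable_gaussianRatio (m : ℝ) : Measurable (gaussianRatio m) := by
  unfold gaussianRatio; fun_prop

lemma gaussianRatio_nonneg (m x : ℝ) : 0 ≤ gaussianRatio m x := by
  unfold gaussianRatio; positivity

lemma gaussianReal_eq_withDensity_gaussianRatio {m : ℝ≥0} (hm : 0 < m) :
    gaussianReal 0 m = (gaussianReal 0 1).withDensity fun x => ENNReal.ofReal (gaussianRatio m x) := by
  rw [gaussianReal_of_var_ne_zero _ hm.ne', gaussianReal_of_var_ne_zero _ one_ne_zero,
    ← withDensity_mul _ (measurable_gaussianPDF _ _) (measurable_gaussianRatio _).ennreal_ofReal]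
  congr 1
  funext x
  have hm' : (0 : ℝ) < m := hm
  rw [Pi.mul_apply, gaussianPDF, gaussianPDF, ← ENNReal.ofReal_mul (gaussianPDFReal_nonneg _ _ _)]
  congr 1
  rw [gaussianPDFReal, gaussianPDFReal, gaussianRatio, Real.sqrt_mul (by positivity)]
  rw [show (-(x - 0) ^ 2 / (2 * (m : ℝ))) = -(x - 0) ^ 2 / (2 * ((1 : ℝ≥0) : ℝ)) + -((1 / (m : ℝ) - 1) / 2) * x ^ 2 by
    push_cast; field_simp; ring, Real.exp_add]
  simp; ring

/-- Against the standard normal density the squared ratio is a Gaussian exponential of rate `1/m -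
1/2`, which is positive because `m < 2`. -/
lemma integrable_gaussianRatio_sq {m : ℝ≥0} (hm : 0 < m) (hm2 : m < 2) :
    Integrable (fun x => gaussianRatio m x ^ 2) (gaussianReal 0 1) ∧
      ∫ x, gaussianRatio m x ^ 2 ∂gaussianReal 0 1 = (√(m * (2 - m)))⁻¹ := by
  have hm' : (0 : ℝ) < m := hm
  have hm2' : (m : ℝ) < 2 := hm2
  have hb : 0 < 1 / (m : ℝ) - 1 / 2 := by
    rw [sub_pos]; exact one_div_lt_one_div_of_lt hm' hm2'
  have key : ∀ x, gaussianPDFReal 0 1 x • gaussianRatio m x ^ 2 =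
      ((√(2 * Real.pi))⁻¹ * (m : ℝ)⁻¹) * Real.exp (-(1 / (m : ℝ) - 1 / 2) * x ^ 2) := fun x => by
    rw [gaussianPDFReal, gaussianRatio, mul_pow, inv_pow, Real.sq_sqrt hm'.le, ← Real.exp_nat_mul, smul_eq_mul,
      show (-(1 / (m : ℝ) - 1 / 2) * x ^ 2) = -(x - 0) ^ 2 / (2 * ((1 : ℝ≥0) : ℝ)) +
        ((2 : ℕ) : ℝ) * (-((1 / (m : ℝ) - 1) / 2) * x ^ 2) by push_cast; ring, Real.exp_add]
    simp; ring
  constructor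
  · rw [gaussianReal_of_var_ne_zero _ one_ne_zero,
      integrable_withDensity_iff_integrable_smul' (measurable_gaussianPDF _ _) (ae_of_all _ fun _ => gaussianPDF_lt_top)]
    simp_rw [toReal_gaussianPDF, key]
    exact (integrable_exp_neg_mul_sq hb).const_mul _
  · rw [integral_gaussianReal_eq_integral_smul one_ne_zero]
    simp_rw [key]
    rw [integral_const_mul, integral_gaussian]
    refine (sq_eq_sq₀ (by positivity) (by positivity)).1 ?_
    have h2 : 0 < 2 - (m : ℝ) := by linarith
    have hpi := Real.pi_pos
    rw [mul_pow, mul_pow, inv_pow, inv_pow, inv_pow, Real.sq_sqrt (by positivity),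
      Real.sq_sqrt (by positivity), Real.sq_sqrt (by positivity)]
    rw [show 1 / (m : ℝ) - 1 / 2 = (2 - m) / (2 * m) by field_simp]
    field_simp

/-- With `y = (m - 1)²` the second moment is `(1 - y)^(-1/2)`. It is at most `exp y` because `(1 +
2y)(1 - y) ≥ 1` for `0 ≤ y ≤ 1/2`, the source of the threshold. The exponential form lets the
coordinates multiply into a sum. -/
lemma integral_gaussianRatio_sq_le {m : ℝ≥0} (h : ((m : ℝ) - 1) ^ 2 ≤ 1 / 2) :
    Integrable (fun x => gaussianRatio m x ^ 2) (gaussianReal 0 1) ∧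
      ∫ x, gaussianRatio m x ^ 2 ∂gaussianReal 0 1 ≤ Real.exp (((m : ℝ) - 1) ^ 2) := by
  have hm' : (0 : ℝ) < m := by nlinarith
  have hm2' : (m : ℝ) < 2 := by nlinarith
  obtain ⟨h1, h2⟩ := integrable_gaussianRatio_sq (m := m) hm' hm2'
  refine ⟨h1, h2.trans_le ?_⟩
  have h3 : 0 < (m : ℝ) * (2 - m) := mul_pos hm' (by linarith)
  rw [inv_le_iff_one_le_mul₀ (by positivity)]
  refine (sq_le_sq₀ zero_le_one (by positivity)).1 ?_
  rw [mul_pow, Real.sq_sqrt h3.le, ← Real.exp_nat_mul]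
  have h4 := Real.add_one_le_exp (((2 : ℕ) : ℝ) * ((m : ℝ) - 1) ^ 2)
  push_cast at h4 ⊢
  set y := ((m : ℝ) - 1) ^ 2 with hy
  have h5 : (m : ℝ) * (2 - m) = 1 - y := by rw [hy]; ring
  have h6 : 0 ≤ y := sq_nonneg _
  rw [h5]
  calc (1 : ℝ) ^ 2 ≤ (2 * y + 1) * (1 - y) := by nlinarith
    _ ≤ _ := mul_le_mul_of_nonneg_right h4 (by linarith)

lemma integral_gaussianRatio {m : ℝ≥0} (hm : 0 < m) : ∫ x, gaussianRatio m x ∂gaussianReal 0 1 = 1 := by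
  have h : ∫⁻ x, ENNReal.ofReal (gaussianRatio m x) ∂gaussianReal 0 1 = 1 := by
    have := measure_univ (μ := gaussianReal 0 m)
    rwa [gaussianReal_eq_withDensity_gaussianRatio hm, withDensity_apply _ MeasurableSet.univ,
      Measure.restrict_univ] at this
  rw [integral_eq_lintegral_of_nonneg_ae (ae_of_all _ (gaussianRatio_nonneg _))
    (measurable_gaussianRatio _).aestronglyMeasurable, h, ENNReal.toReal_one]

/-- The total variation distance of `N(0, I)` and `N(0, diag m)` is at most `√(2 ∑ (mᵢ - 1)²)`. -/
lemma abs_pi_gaussianReal_sub_le {ι : Type*} [Fintype ι] (m : ι → ℝ≥0) {A : Set (ι → ℝ)}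
    (hA : MeasurableSet A) :
    |(Measure.pi fun _ : ι => gaussianReal 0 1).real A -
      (Measure.pi fun i => gaussianReal 0 (m i)).real A| ≤ √(2 * ∑ i, ((m i : ℝ) - 1) ^ 2) := by
  set S := ∑ i, ((m i : ℝ) - 1) ^ 2 with hS
  -- For `S > 1/2` the claimed bound exceeds one and nothing is to be shown.
  rcases lt_or_ge (1 / 2) S with hS2 | hS2
  · refine (abs_sub_le_of_le_of_le measureReal_nonneg measureReal_le_one measureReal_nonneg
      measureReal_le_one).trans ?_
    rw [sub_zero]
    exact Real.one_le_sqrt.2 (by linarith)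
  have hmi : ∀ i, ((m i : ℝ) - 1) ^ 2 ≤ 1 / 2 := fun i =>
    (Finset.single_le_sum (f := fun i => ((m i : ℝ) - 1) ^ 2) (fun i _ => sq_nonneg _) (Finset.mem_univ i)).trans hS2
  have hpos : ∀ i, 0 < m i := fun i => by
    have := hmi i
    have : (0 : ℝ) < m i := by nlinarith
    exact this
  have hP : (Measure.pi fun i => gaussianReal 0 (m i)) = (Measure.pi fun _ : ι => gaussianReal 0 1).withDensity
      fun x => ENNReal.ofReal (∏ i, gaussianRatio (m i) (x i)) := by
    have hinst : ∀ i, SigmaFinite ((gaussianReal 0 1).withDensity fun x => ENNReal.ofReal (gaussianRatio (m i) x)) :=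
      fun i => by rw [← gaussianReal_eq_withDensity_gaussianRatio (hpos i)]; infer_instance
    rw [show (fun i => gaussianReal 0 (m i)) = fun i => (gaussianReal 0 1).withDensity
      (fun x => ENNReal.ofReal (gaussianRatio (m i) x)) from
        funext fun i => gaussianReal_eq_withDensity_gaussianRatio (hpos i),
      pi_withDensity_eq (fun _ : ι => gaussianReal 0 1) _ fun i => (measurable_gaussianRatio _).ennreal_ofReal]
    congr 1
    funext x
    rw [ENNReal.ofReal_prod_of_nonneg fun i _ => gaussianRatio_nonneg _ _]
  rw [hP]
  refine (abs_measureReal_withDensity_sub_le _ ?_ ?_ ?_ ?_ hA).trans ?_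
  · exact Finset.measurable_prod _ fun i _ => (measurable_gaussianRatio _).comp (measurable_pi_apply i)
  · exact fun x => Finset.prod_nonneg fun i _ => gaussianRatio_nonneg _ _
  · rw [integral_fintype_prod_eq_prod (fun i x => gaussianRatio (m i) x)]
    exact Finset.prod_eq_one fun i _ => integral_gaussianRatio (hpos i)
  · simp_rw [← Finset.prod_pow]
    exact Integrable.fintype_prod (f := fun i x => gaussianRatio (m i) x ^ 2)
      fun i => (integral_gaussianRatio_sq_le (hmi i)).1
  · refine Real.sqrt_le_sqrt ?_
    simp_rw [← Finset.prod_pow]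
    rw [integral_fintype_prod_eq_prod (fun i x => gaussianRatio (m i) x ^ 2)]
    have h1 : ∏ i, ∫ x, gaussianRatio (m i) x ^ 2 ∂gaussianReal 0 1 ≤ Real.exp S := by
      rw [hS, Real.exp_sum]
      exact Finset.prod_le_prod (fun i _ => integral_nonneg fun x => sq_nonneg _)
        fun i _ => (integral_gaussianRatio_sq_le (hmi i)).2
    have hS0 : 0 ≤ S := Finset.sum_nonneg fun i _ => sq_nonneg _
    -- The factor 2 enters here: `exp S - 1 ≤ 2 S` for `0 ≤ S ≤ 1`.
    have h2 := Real.abs_exp_sub_one_le (x := S) (by rw [abs_of_nonneg hS0]; linarith)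
    rw [abs_of_nonneg hS0] at h2
    linarith [le_abs_self (Real.exp S - 1)]

/-! ### Simultaneous diagonalisation of two Hilbertian forms -/

/-- Spectral theorem on the finite-dimensional space `T₁ (span s)`: with `A = T₂ ∘ T₁⁻¹` there, an
orthonormal eigenbasis of `A* A` has `A`-images that are pairwise orthogonal. Pulling it back along
`T₁` gives `e`. -/
lemma exists_orthonormal_orthogonal {E H : Type*} [AddCommGroup E] [Module ℝ E]
    [NormedAddCommGroup H] [InnerProductSpace ℝ H] [CompleteSpace H] (T₁ T₂ : E →ₗ[ℝ] H)
    (hT : Function.Injective T₁) (s : Finset E) :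
    ∃ (n : ℕ) (e : Fin n → E), (∀ f ∈ s, f ∈ Submodule.span ℝ (Set.range e)) ∧
      Orthonormal ℝ (fun i => T₁ (e i)) ∧ ∀ i j, i ≠ j → inner ℝ (T₂ (e i)) (T₂ (e j)) = 0 := by
  let F : Submodule ℝ E := Submodule.span ℝ (s : Set E)
  have : FiniteDimensional ℝ F := FiniteDimensional.span_finset ℝ s
  let F' : Submodule ℝ H := F.map T₁
  let φ : F ≃ₗ[ℝ] F' := Submodule.equivMapOfInjective T₁ hT F
  have : FiniteDimensional ℝ F' := φ.finiteDimensional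
  let A : F' →L[ℝ] H := LinearMap.toContinuousLinearMap (T₂ ∘ₗ F.subtype ∘ₗ φ.symm.toLinearMap)
  let S : F' →ₗ[ℝ] F' := (A.adjoint ∘L A).toLinearMap
  have hSin : ∀ x y, inner ℝ (S x) y = inner ℝ (A x) (A y) := fun x y => by
    simp [S, ContinuousLinearMap.adjoint_inner_left]
  have hS : S.IsSymmetric := fun x y => by
    rw [hSin, real_inner_comm, ← hSin, real_inner_comm]
  let e' := hS.eigenvectorBasis rfl
  refine ⟨_, fun i => (φ.symm (e' i) : E), fun f hf => ?_, ?_, fun i j hij => ?_⟩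
  · have h1 : (⟨f, Submodule.subset_span hf⟩ : F) ∈ Submodule.span ℝ (Set.range fun i => φ.symm (e' i)) := by
      have := (e'.toBasis.map φ.symm).mem_span ⟨f, Submodule.subset_span hf⟩
      have h3 : ⇑(e'.toBasis.map φ.symm) = fun i => φ.symm (e' i) := by ext i; simp
      rwa [h3] at this
    have h2 := Submodule.mem_map_of_mem (f := F.subtype) h1
    rwa [Submodule.map_span, ← Set.range_comp] at h2
  · have h1 : ∀ i, T₁ (φ.symm (e' i) : E) = (e' i : H) := fun i => by
      conv_rhs => rw [← φ.apply_symm_apply (e' i)]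
      rfl
    simp_rw [h1]
    exact e'.orthonormal.comp_linearIsometry F'.subtypeₗᵢ
  · have h1 : inner ℝ (A (e' i)) (A (e' j)) = 0 := by
      rw [← hSin, hS.apply_eigenvectorBasis, inner_smul_left, e'.orthonormal.2 hij, mul_zero]
    exact h1

/-! ### Total variation distance and cylinder sets -/

open scoped symmDiff in
lemma abs_measureReal_sub_le_symmDiff {X : Type*} [MeasurableSpace X] (μ : Measure X)
    [IsFiniteMeasure μ] (A B : Set X) : |μ.real A - μ.real B| ≤ μ.real (A ∆ B) := by
  have h : ∀ A B : Set X, μ.real A ≤ μ.real B + μ.real (A ∆ B) := fun A B => by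
    refine (measureReal_mono ?_).trans (measureReal_union_le _ _)
    intro x hx
    by_cases hB : x ∈ B
    · exact Or.inl hB
    · exact Or.inr (Or.inl ⟨hx, hB⟩)
  rw [abs_le]
  have h1 := h A B
  have h2 := h B A
  rw [symmDiff_comm] at h2
  constructor <;> linarith

open scoped symmDiff in
-- Cylinders form an algebra generating the product σ-algebra, so any measurable set is approximated
-- by a cylinder in `μ + ν` measure, hence under both measures at once.
lemma abs_measureReal_sub_le_of_measurableCylinders {ι : Type*} {α : ι → Type*}
    [∀ i, MeasurableSpace (α i)] (μ ν : Measure (∀ i, α i)) [IsFiniteMeasure μ] [IsFiniteMeasure ν]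
    {c : ℝ} (h : ∀ A ∈ measurableCylinders α, |μ.real A - ν.real A| ≤ c) {A : Set (∀ i, α i)}
    (hA : MeasurableSet A) : |μ.real A - ν.real A| ≤ c := by
  refine le_of_forall_pos_le_add fun δ hδ => ?_
  obtain ⟨t, ht, hlt⟩ := (Measure.MeasureDense.of_generateFrom_isSetAlgebra_finite (μ + ν)
    isSetAlgebra_measurableCylinders generateFrom_measurableCylinders.symm).approx A hA
      (measure_ne_top _ _) δ hδ
  have h1 : (μ + ν).real (A ∆ t) ≤ δ := ENNReal.toReal_le_of_le_ofReal hδ.le hlt.le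
  rw [measureReal_add_apply] at h1
  have h2 := abs_measureReal_sub_le_symmDiff μ A t
  have h3 := abs_measureReal_sub_le_symmDiff ν A t
  have h4 := h t ht
  rw [abs_le] at *
  constructor <;> linarith

end LeCam

namespace Volatility
open LeCam

/-! ### Tail integrals -/

/-- The tail integral `∫ₛ¹ f(t) dt`. -/
noncomputable def tailIntegral (f : L2I) (s : unitInterval) : ℝ := ∫ t in Set.Ici s, f t

lemma integrable_coe (f : L2I) : Integrable (f : unitInterval → ℝ) :=
  (Lp.memLp f).integrable (by norm_num)

lemma integral_coe_sq (f : L2I) : ∫ t, f t ^ 2 = ‖f‖ ^ 2 := by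
  rw [← real_inner_self_eq_norm_sq, L2.inner_def]
  exact integral_congr_ae (ae_of_all _ fun t => by simp [sq])

/-- Fubini on the triangle `s ≤ t`. -/
lemma integral_mul_setIntegral_Iic {a b : unitInterval → ℝ} (ha : Integrable a) (hb : Integrable b) :
    ∫ t, a t * ∫ s in Set.Iic t, b s = ∫ s, b s * ∫ t in Set.Ici s, a t := by
  have h1 : ∀ t, a t * ∫ s in Set.Iic t, b s =
      ∫ s, ({p : unitInterval × unitInterval | p.2 ≤ p.1}.indicator fun p => a p.1 * b p.2) (t, s) := fun t => by
    rw [← integral_indicator measurableSet_Iic, ← integral_const_mul]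
    congr 1; ext s
    by_cases h : s ≤ t <;> simp [h]
  have h2 : ∀ s, b s * ∫ t in Set.Ici s, a t =
      ∫ t, ({p : unitInterval × unitInterval | p.2 ≤ p.1}.indicator fun p => a p.1 * b p.2) (t, s) := fun s => by
    rw [← integral_indicator measurableSet_Ici, ← integral_const_mul]
    congr 1; ext t
    by_cases h : s ≤ t <;> simp [h, mul_comm]
  simp_rw [h1, h2]
  refine integral_integral_swap ?_
  exact (ha.mul_prod hb).indicator (measurableSet_le measurable_snd measurable_fst)

lemma integrable_mul_setIntegral_Ici {g : unitInterval → ℝ} (hg : Integrable g) :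
    Integrable fun t => g t * ∫ s in Set.Ici t, g s := by
  have hK : ∀ t, ‖∫ s in Set.Ici t, g s‖ ≤ ∫ s, ‖g s‖ := fun t =>
    (norm_integral_le_integral_norm _).trans
      (setIntegral_le_integral hg.norm (ae_of_all _ fun _ => norm_nonneg _))
  refine hg.mul_bdd ?_ (ae_of_all _ hK)
  have h3 : ∀ t : unitInterval, ∫ s in Set.Ici t, g s =
      ∫ s, ({p : unitInterval × unitInterval | p.1 ≤ p.2}.indicator fun p => g p.2) (t, s) := fun t => by
    rw [← integral_indicator measurableSet_Ici]
    congr 1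
  simp_rw [h3]
  exact (hg.1.comp_snd.indicator (measurableSet_le measurable_fst measurable_snd)).integral_prod_right'

/-- The square is symmetric about its diagonal, so the double integral of `g(t) g(u)` is twice that
over `t ≤ u`. This is `-(G²)' = 2 g G` for the tail integral `G`, without differentiation. -/
lemma sq_integral_eq {g : unitInterval → ℝ} (hg : Integrable g) :
    (∫ t, g t) ^ 2 = 2 * ∫ t, g t * ∫ u in Set.Ici t, g u := by
  have h1 := integral_mul_setIntegral_Iic hg hg
  have hmeas : ∀ t, ∫ s in Set.Iic t, g s = (∫ s, g s) - ∫ s in Set.Ici t, g s := fun t => by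
    rw [← setIntegral_congr_set (Ioi_ae_eq_Ici (a := t)), eq_sub_iff_add_eq, ← Set.compl_Iic]
    exact integral_add_compl measurableSet_Iic hg
  simp_rw [hmeas, mul_sub] at h1
  rw [integral_sub (hg.mul_const _) (integrable_mul_setIntegral_Ici hg), integral_mul_const] at h1
  linarith [sq (∫ t, g t)]

lemma measurable_tailIntegral (f : L2I) : Measurable (tailIntegral f) := by
  have h : tailIntegral f = fun s : unitInterval => ∫ t,
      ({p : unitInterval × unitInterval | p.1 ≤ p.2}.indicator fun p => f p.2) (s, t) := by
    funext s
    rw [tailIntegral, ← integral_indicator measurableSet_Ici]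
    congr 1
  rw [h]
  refine StronglyMeasurable.measurable (StronglyMeasurable.integral_prod_right'
    (f := {p : unitInterval × unitInterval | p.1 ≤ p.2}.indicator fun p => f p.2) ?_)
  exact ((Lp.stronglyMeasurable f).comp_measurable measurable_snd).indicator
    (measurableSet_le measurable_fst measurable_snd)

lemma norm_tailIntegral_le (f : L2I) (s : unitInterval) : ‖tailIntegral f s‖ ≤ ∫ t, ‖f t‖ :=
  (norm_integral_le_integral_norm _).trans
    (setIntegral_le_integral (integrable_coe f).norm (ae_of_all _ fun _ => norm_nonneg _))

lemma tailIntegral_add (f g : L2I) : tailIntegral (f + g) = tailIntegral f + tailIntegral g := by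
  funext s
  simp only [tailIntegral, Pi.add_apply]
  rw [← integral_add (integrable_coe f).integrableOn (integrable_coe g).integrableOn]
  exact integral_congr_ae (ae_restrict_of_ae (Lp.coeFn_add f g))

lemma tailIntegral_smul (c : ℝ) (f : L2I) : tailIntegral (c • f) = c • tailIntegral f := by
  funext s
  simp only [tailIntegral, Pi.smul_apply, smul_eq_mul]
  rw [← integral_const_mul]
  refine integral_congr_ae (ae_restrict_of_ae ?_)
  filter_upwards [Lp.coeFn_smul c f] with x hx
  simp [hx]

/-- Tail integration at `s` as a linear form. -/
noncomputable def tailForm (s : unitInterval) : L2I →ₗ[ℝ] ℝ where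
  toFun f := tailIntegral f s
  map_add' f g := by rw [tailIntegral_add]; rfl
  map_smul' c f := by rw [tailIntegral_smul]; rfl

lemma integrable_tailIntegral_sq (f : L2I) : Integrable fun s => tailIntegral f s ^ 2 := by
  have : MemLp (tailIntegral f) 2 (volume : Measure unitInterval) :=
    MemLp.of_bound (measurable_tailIntegral f).aestronglyMeasurable _ (ae_of_all _ (norm_tailIntegral_le f))
  exact this.integrable_sq

/-- Interpolation between `F` and its derivative: `F(s)² = 2 ∫ₛ¹ f F`, and `2 √b ε f F ≤ b F² + ε²
f²` pointwise. Only one power of `ε` is lost, whence the rate `ε^(-1/2)`. -/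
lemma tailIntegral_sq_le (f : L2I) (s : unitInterval) {b ε : ℝ} (hb : 0 < b) (hε : 0 < ε) :
    √b * ε * tailIntegral f s ^ 2 ≤ b * (∫ t, tailIntegral f t ^ 2) + ε ^ 2 * ‖f‖ ^ 2 := by
  have hF := (integrable_coe f).indicator (measurableSet_Ici (a := s))
  have h1 := sq_integral_eq hF
  rw [integral_indicator measurableSet_Ici] at h1
  change tailIntegral f s ^ 2 = _ at h1
  rw [h1, ← integral_coe_sq, ← integral_const_mul, ← integral_const_mul, ← integral_const_mul, ← integral_const_mul,
    ← integral_add ((integrable_tailIntegral_sq f).const_mul _) ((Lp.memLp f).integrable_sq.const_mul _)]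
  refine integral_mono (((integrable_mul_setIntegral_Ici hF).const_mul _).const_mul _)
    (((integrable_tailIntegral_sq f).const_mul _).add ((Lp.memLp f).integrable_sq.const_mul _)) fun t => ?_
  beta_reduce
  by_cases ht : s ≤ t
  · have h2 : ∫ u in Set.Ici t, (Set.Ici s).indicator f u = tailIntegral f t :=
      setIntegral_congr_fun measurableSet_Ici fun u hu => Set.indicator_of_mem (show u ∈ Set.Ici s from ht.trans hu) _
    rw [h2, Set.indicator_of_mem (show t ∈ Set.Ici s from ht)]
    have h3 := sq_nonneg (√b * tailIntegral f t - ε * f t)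
    have h4 : b * tailIntegral f t ^ 2 = (√b * tailIntegral f t) ^ 2 := by rw [mul_pow, Real.sq_sqrt hb.le]
    rw [h4]
    nlinarith
  · rw [Set.indicator_of_notMem (show t ∉ Set.Ici s from ht)]
    simp only [zero_mul, mul_zero]
    positivity

/-! ### The signal operator -/

variable {σ : unitInterval → ℝ}

lemma memLp_mul_tailIntegral (hσ : MemLp σ 2 (volume : Measure unitInterval)) (f : L2I) :
    MemLp (fun s => σ s * tailIntegral f s) 2 (volume : Measure unitInterval) := by
  have hF : MemLp (tailIntegral f) ∞ (volume : Measure unitInterval) :=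
    memLp_top_of_bound (measurable_tailIntegral f).aestronglyMeasurable _ (ae_of_all _ (norm_tailIntegral_le f))
  exact hF.mul hσ

/-- The operator `f ↦ σ(s) ∫ₛ¹ f(t) dt`, so that `∫ f(t) X_t dt` is the Wiener integral of the
image of `f`. -/
noncomputable def signalOp (hσ : MemLp σ 2 (volume : Measure unitInterval)) : L2I →ₗ[ℝ] L2I where
  toFun f := (memLp_mul_tailIntegral hσ f).toLp _
  map_add' f g := by
    rw [← MemLp.toLp_add]
    exact MemLp.toLp_congr _ _ (ae_of_all _ fun s => by simp [tailIntegral_add, mul_add])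
  map_smul' c f := by
    rw [RingHom.id_apply, ← MemLp.toLp_const_smul]
    exact MemLp.toLp_congr _ _ (ae_of_all _ fun s => by simp [tailIntegral_smul]; ring)

lemma coeFn_signalOp (hσ : MemLp σ 2 (volume : Measure unitInterval)) (f : L2I) :
    signalOp hσ f =ᵐ[volume] fun s => σ s * tailIntegral f s :=
  (memLp_mul_tailIntegral hσ f).coeFn_toLp

lemma norm_signalOp_sq (hσ : MemLp σ 2 (volume : Measure unitInterval)) (f : L2I) :
    ‖signalOp hσ f‖ ^ 2 = ∫ s, σ s ^ 2 * tailIntegral f s ^ 2 := by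
  rw [← integral_coe_sq]
  refine integral_congr_ae ?_
  filter_upwards [coeFn_signalOp hσ f] with s hs
  rw [hs, mul_pow]

lemma integrable_sq_mul_tailIntegral_sq (hσ : MemLp σ 2 (volume : Measure unitInterval)) (f : L2I) :
    Integrable fun s => σ s ^ 2 * tailIntegral f s ^ 2 := by
  simpa only [mul_pow] using (memLp_mul_tailIntegral hσ f).integrable_sq

/-- The linear map `f ↦ (σ ∫ₛ¹ f, ε f)`, whose squared norm is the variance of `Y_f`. -/
noncomputable def obsOp (hσ : MemLp σ 2 (volume : Measure unitInterval)) (ε : ℝ) :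
    L2I →ₗ[ℝ] WithLp 2 (L2I × L2I) :=
  (WithLp.linearEquiv 2 ℝ (L2I × L2I)).symm.toLinearMap ∘ₗ
    (signalOp hσ).prod (ε • LinearMap.id)

lemma norm_obsOp_sq (hσ : MemLp σ 2 (volume : Measure unitInterval)) (ε : ℝ) (f : L2I) :
    ‖obsOp hσ ε f‖ ^ 2 = (∫ s, σ s ^ 2 * tailIntegral f s ^ 2) + ε ^ 2 * ‖f‖ ^ 2 := by
  rw [WithLp.prod_norm_sq_eq_of_L2, ← norm_signalOp_sq hσ]
  congr 1
  change ‖ε • f‖ ^ 2 = _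
  rw [norm_smul, mul_pow, Real.norm_eq_abs, sq_abs]

lemma injective_obsOp (hσ : MemLp σ 2 (volume : Measure unitInterval)) {ε : ℝ} (hε : 0 < ε) :
    Function.Injective (obsOp hσ ε) := by
  intro f g hfg
  have h : ε • f = ε • g := congrArg (fun x : WithLp 2 (L2I × L2I) => x.snd) hfg
  exact smul_right_injective _ hε.ne' h

lemma mul_integral_tail_sq_le (hσ : MemLp σ 2 (volume : Measure unitInterval)) {b : ℝ}
    (hb : ∀ s, b ≤ σ s ^ 2) (f : L2I) :
    b * ∫ s, tailIntegral f s ^ 2 ≤ ∫ s, σ s ^ 2 * tailIntegral f s ^ 2 := by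
  rw [← integral_const_mul]
  exact integral_mono ((integrable_tailIntegral_sq f).const_mul _)
    (integrable_sq_mul_tailIntegral_sq hσ f) fun s => mul_le_mul_of_nonneg_right (hb s) (sq_nonneg _)

/-- Bessel's inequality for the evaluation functional `f ↦ ∫ₛ¹ f`. -/
lemma sum_tailIntegral_sq_le (hσ : MemLp σ 2 (volume : Measure unitInterval)) {b ε : ℝ} (hb0 : 0 < b)
    (hε : 0 < ε) (hb : ∀ s, b ≤ σ s ^ 2) {ι : Type*} [Fintype ι] {e : ι → L2I}
    (he : Orthonormal ℝ fun i => obsOp hσ ε (e i)) (s : unitInterval) :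
    ∑ i, tailIntegral (e i) s ^ 2 ≤ (√b * ε)⁻¹ := by
  set S := ∑ i, tailIntegral (e i) s ^ 2 with hS
  -- The Riesz representer of evaluation at `s` within the span: its tail integral at `s` and its
  -- squared norm both equal `S`, so the evaluation bound reads `√b ε S² ≤ S`.
  let g : L2I := ∑ i, tailIntegral (e i) s • e i
  have h1 : tailIntegral g s = S := by
    change tailForm s g = S
    simp only [g, map_sum, map_smul, smul_eq_mul, hS, sq]
    rfl
  have h2 : ‖obsOp hσ ε g‖ ^ 2 = S := by
    rw [← real_inner_self_eq_norm_sq]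
    simp only [g, map_sum, map_smul]
    rw [he.inner_sum]
    simp [hS, sq]
  have h3 := tailIntegral_sq_le g s hb0 hε
  have h4 := mul_integral_tail_sq_le hσ hb g
  rw [norm_obsOp_sq] at h2
  rw [h1] at h3
  have h5 : √b * ε * S ^ 2 ≤ S := by linarith
  have h6 : 0 < √b * ε := by positivity
  have h0 : 0 ≤ S := Finset.sum_nonneg fun i _ => sq_nonneg _
  rcases h0.eq_or_lt with h0 | h0
  · rw [← h0]; positivity
  · rw [← one_div, le_div_iff₀ h6]
    refine le_of_mul_le_mul_right ?_ h0
    linarith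

/-- The key estimate for the difference of two covariance forms. -/
lemma sum_norm_obsOp_sq_sub_one_sq_le {σ₁ σ₂ : unitInterval → ℝ}
    (hσ₁ : MemLp σ₁ 2 (volume : Measure unitInterval)) (hσ₂ : MemLp σ₂ 2 (volume : Measure unitInterval))
    {b ε δ : ℝ} (hb0 : 0 < b) (hε : 0 < ε) (hb : ∀ s, b ≤ σ₁ s ^ 2)
    (hδ : ∀ s, |σ₂ s ^ 2 - σ₁ s ^ 2| ≤ δ) {ι : Type*} [Fintype ι] {e : ι → L2I}
    (he : Orthonormal ℝ fun i => obsOp hσ₁ ε (e i)) :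
    ∑ i, (‖obsOp hσ₂ ε (e i)‖ ^ 2 - 1) ^ 2 ≤ δ ^ 2 * (b⁻¹ * (√b * ε)⁻¹) := by
  set y : ι → ℝ := fun i => ∫ s, tailIntegral (e i) s ^ 2 with hy
  have hy0 : ∀ i, 0 ≤ y i := fun i => integral_nonneg fun s => sq_nonneg _
  have hn : ∀ i, ‖obsOp hσ₁ ε (e i)‖ ^ 2 = 1 := fun i => by rw [he.1 i, one_pow]
  have hyb : ∀ i, y i ≤ b⁻¹ := fun i => by
    have h1 := mul_integral_tail_sq_le hσ₁ hb (e i)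
    have h2 := hn i
    rw [norm_obsOp_sq] at h2
    have h3 : 0 ≤ ε ^ 2 * ‖e i‖ ^ 2 := by positivity
    rw [← one_div, le_div_iff₀ hb0, mul_comm]
    linarith
  have hys : ∑ i, y i ≤ (√b * ε)⁻¹ := by
    rw [hy, ← integral_finsetSum _ fun i _ => integrable_tailIntegral_sq (e i)]
    refine (integral_mono (integrable_finsetSum _ fun i _ => integrable_tailIntegral_sq (e i))
      (integrable_const _) (sum_tailIntegral_sq_le hσ₁ hb0 hε hb he)).trans_eq (by simp)
  have hx : ∀ i, |‖obsOp hσ₂ ε (e i)‖ ^ 2 - 1| ≤ δ * y i := fun i => by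
    rw [← hn i, norm_obsOp_sq, norm_obsOp_sq, add_sub_add_right_eq_sub,
      ← integral_sub (integrable_sq_mul_tailIntegral_sq hσ₂ _) (integrable_sq_mul_tailIntegral_sq hσ₁ _),
      hy, ← integral_const_mul]
    refine abs_integral_le_integral_abs.trans (integral_mono ?_ ((integrable_tailIntegral_sq _).const_mul _) fun s => ?_)
    · exact ((integrable_sq_mul_tailIntegral_sq hσ₂ _).sub (integrable_sq_mul_tailIntegral_sq hσ₁ _)).abs
    · beta_reduce
      rw [← sub_mul, abs_mul, abs_of_nonneg (sq_nonneg (tailIntegral (e i) s))]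
      exact mul_le_mul_of_nonneg_right (hδ s) (sq_nonneg _)
  -- One factor of `yᵢ²` is bounded by `b⁻¹`, the other is kept for the trace bound `hys`.
  calc ∑ i, (‖obsOp hσ₂ ε (e i)‖ ^ 2 - 1) ^ 2 ≤ ∑ i, δ ^ 2 * (b⁻¹ * y i) := by
        refine Finset.sum_le_sum fun i _ => ?_
        rw [← sq_abs]
        calc _ ≤ (δ * y i) ^ 2 := pow_le_pow_left₀ (abs_nonneg _) (hx i) 2
          _ = δ ^ 2 * (y i * y i) := by ring
          _ ≤ _ := mul_le_mul_of_nonneg_left (mul_le_mul_of_nonneg_right (hyb i) (hy0 i)) (sq_nonneg _)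
    _ = δ ^ 2 * (b⁻¹ * ∑ i, y i) := by rw [Finset.mul_sum, Finset.mul_sum]
    _ ≤ _ := by gcongr

/-- Stochastic Fubini. The Wiener integral is a linear isometry and commutes with the Bochner
integral; the resulting integral in `L²([0,1])` is identified by testing against `φ` and exchanging
integrals on the triangle. -/
lemma integral_smul_signal_eq {Ω : Type*} [MeasurableSpace Ω] {P : Measure Ω} {B : ℝ≥0 → Ω → ℝ}
    (hB : IsBrownianReal B P) (hσ : MemLp σ 2 (volume : Measure unitInterval)) (f : L2I) :
    ∫ t : unitInterval, f t • signal hB hσ t = wienerIntegral hB (signalOp hσ f) := by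
  let L : L2I →ₗᵢ[ℝ] Lp ℝ 2 P := ⟨(wienerIntegral hB).toLinearMap, norm_wienerIntegral hB⟩
  let g : unitInterval → L2I := fun t => f t • (hσ.indicator (measurableSet_Iic (a := t))).toLp _
  have hLg : ∀ t, f t • signal hB hσ t = L (g t) := fun t => by
    simp only [g, map_smul]; rfl
  have hgi : Integrable g := by
    have h1 := integrable_signal hB hσ f
    simp_rw [hLg] at h1
    exact (L.lipschitz.integrable_comp_iff_of_antilipschitz L.antilipschitz L.map_zero).1 h1
  simp_rw [hLg]
  rw [L.integral_comp_comm]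
  change wienerIntegral hB _ = _
  congr 1
  refine ext_inner_left ℝ fun φ => ?_
  rw [← integral_inner hgi]
  have hφσ : Integrable fun s => φ s * σ s := (Lp.memLp φ).integrable_mul hσ
  have h2 : ∀ t, inner ℝ φ (g t) = f t * ∫ s in Set.Iic t, φ s * σ s := fun t => by
    simp only [g, inner_smul_right]
    congr 1
    rw [L2.inner_def, ← integral_indicator measurableSet_Iic]
    refine integral_congr_ae ?_
    filter_upwards [(hσ.indicator (measurableSet_Iic (a := t))).coeFn_toLp] with s hs
    rw [hs]
    by_cases h : s ≤ t <;> simp [h, mul_comm]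
  simp_rw [h2]
  rw [integral_mul_setIntegral_Iic (integrable_coe f) hφσ, L2.inner_def]
  refine integral_congr_ae ?_
  filter_upwards [coeFn_signalOp hσ f] with s hs
  rw [hs, tailIntegral]
  simp; ring

end Volatility

namespace Volatility
open LeCam

/-! ### Gaussianity of the observations -/

variable {Ω : Type*} [MeasurableSpace Ω] {P : Measure Ω} {B W : ℝ≥0 → Ω → ℝ} {σ : unitInterval → ℝ}

lemma coeFn_lp_sum_smul {ι : Type*} (s : Finset ι) (c : ι → ℝ) (X : ι → Lp ℝ 2 P) :
    ((∑ i ∈ s, c i • X i : Lp ℝ 2 P) : Ω → ℝ) =ᵐ[P] fun ω => ∑ i ∈ s, c i * X i ω := by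
  have h : ∀ᵐ ω ∂P, ∀ i ∈ s, (c i • X i : Lp ℝ 2 P) ω = c i * X i ω := by
    refine (ae_ball_iff s.countable_toSet).2 fun i _ => ?_
    filter_upwards [Lp.coeFn_smul (c i) (X i)] with ω hω
    rw [hω]; rfl
  filter_upwards [Lp.coeFn_finsetSum s fun i => c i • X i, h] with ω h1 h2
  rw [h1, Finset.sum_apply]
  exact Finset.sum_congr rfl h2

lemma coeFn_elemIntegral (hB : IsBrownianReal B P) (c : unitInterval →₀ ℝ) :
    elemIntegral hB c =ᵐ[P] fun ω => ∑ t ∈ c.support, c t • B (unitInterval.toNNReal t) ω := by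
  have h : ∀ᵐ ω ∂P, ∀ t ∈ c.support,
      (memLp_brownian hB (unitInterval.toNNReal t)).toLp _ ω = B (unitInterval.toNNReal t) ω := by
    exact (ae_ball_iff c.support.countable_toSet).2 fun t _ => (memLp_brownian hB (unitInterval.toNNReal t)).coeFn_toLp
  rw [elemIntegral, Finsupp.linearCombination_apply, Finsupp.sum]
  filter_upwards [coeFn_lp_sum_smul c.support c
    fun t => (memLp_brownian hB (unitInterval.toNNReal t)).toLp _, h] with ω h1 h2
  rw [h1]
  exact Finset.sum_congr rfl fun t ht => by rw [h2 t ht]; rfl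

lemma hasLaw_elemSum (hB : IsBrownianReal B P) (c : unitInterval →₀ ℝ) :
    HasLaw (fun ω => ∑ t ∈ c.support, c t • B (unitInterval.toNNReal t) ω)
      (gaussianReal 0 (‖stepFun c‖₊ ^ 2)) P := by
  have := hB.isGaussianProcess.isProbabilityMeasure
  have hG : HasGaussianLaw (fun ω => ∑ t ∈ c.support, c t • B (unitInterval.toNNReal t) ω) P :=
    ((hB.isGaussianProcess.comp_right unitInterval.toNNReal).smul c).hasGaussianLaw_fun_sum
  refine ⟨hG.aemeasurable, ?_⟩
  have hm : ∫ ω, ∑ t ∈ c.support, c t • B (unitInterval.toNNReal t) ω ∂P = 0 := by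
    rw [integral_finsetSum (f := fun t ω => c t • B (unitInterval.toNNReal t) ω) _
      fun t _ => (hB.integrable_eval _).smul (c t)]
    refine Finset.sum_eq_zero fun t _ => ?_
    rw [integral_smul, hB.integral_eval, smul_zero]
  have hv : Var[fun ω => ∑ t ∈ c.support, c t • B (unitInterval.toNNReal t) ω; P] = ‖stepFun c‖ ^ 2 := by
    rw [variance_eq_sub hG.memLp_two, hm, ← norm_elemIntegral hB, ← real_inner_self_eq_norm_sq, L2.inner_def]
    rw [zero_pow two_ne_zero, sub_zero]
    refine integral_congr_ae ?_
    filter_upwards [coeFn_elemIntegral hB c] with ω hω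
    rw [hω]; simp [sq]
  rw [hG.map_eq_gaussianReal, hm, hv]
  congr 1
  ext; simp

/-- `E exp(i X)` for `X ∈ L²(P)`. -/
noncomputable def charVal (X : Lp ℝ 2 P) : ℂ := ∫ ω, Complex.exp (X ω * Complex.I) ∂P

lemma integrable_exp_mul_I [IsFiniteMeasure P] {X : Ω → ℝ} (hX : AEStronglyMeasurable X P) :
    Integrable (fun ω => Complex.exp (X ω * Complex.I)) P := by
  refine Integrable.of_bound (C := 1) ?_ (ae_of_all _ fun ω => by rw [Complex.norm_exp_ofReal_mul_I])
  have : Continuous fun x : ℝ => Complex.exp (x * Complex.I) := by fun_prop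
  exact this.comp_aestronglyMeasurable hX

lemma norm_exp_mul_I_sub_le (a b : ℝ) :
    ‖Complex.exp (a * Complex.I) - Complex.exp (b * Complex.I)‖ ≤ |a - b| := by
  have h : Complex.exp (a * Complex.I) - Complex.exp (b * Complex.I) =
      Complex.exp (b * Complex.I) * (Complex.exp (Complex.I * ((a - b : ℝ) : ℂ)) - 1) := by
    rw [mul_sub, ← Complex.exp_add, mul_one]
    congr 2; push_cast; ring
  rw [h, norm_mul, Complex.norm_exp_ofReal_mul_I, one_mul]
  exact Real.norm_exp_I_mul_ofReal_sub_one_le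

lemma integral_abs_le_norm [IsProbabilityMeasure P] (X : Lp ℝ 2 P) : ∫ ω, |X ω| ∂P ≤ ‖X‖ := by
  have hL : MemLp (fun ω => |X ω|) 2 P := (Lp.memLp X).abs
  have hv := variance_nonneg (fun ω => |X ω|) P
  rw [variance_eq_sub hL, sub_nonneg] at hv
  refine (sq_le_sq₀ (integral_nonneg fun _ => abs_nonneg _) (norm_nonneg _)).1 (hv.trans_eq ?_)
  rw [← real_inner_self_eq_norm_sq, L2.inner_def]
  exact integral_congr_ae (ae_of_all _ fun ω => by simp [sq])

/-- Since `x ↦ exp(i x)` is 1-Lipschitz and `L¹` norms are bounded by `L²` norms, `charVal` is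
1-Lipschitz. This carries the Gaussian formula from step functions to all of `L²([0,1])`. -/
lemma continuous_charVal [IsProbabilityMeasure P] : Continuous (charVal : Lp ℝ 2 P → ℂ) := by
  refine (LipschitzWith.of_dist_le_mul (K := 1) fun X Y => ?_).continuous
  rw [dist_eq_norm, dist_eq_norm, NNReal.coe_one, one_mul, charVal, charVal,
    ← integral_sub (integrable_exp_mul_I (Lp.aestronglyMeasurable X)) (integrable_exp_mul_I (Lp.aestronglyMeasurable Y))]
  refine (norm_integral_le_integral_norm _).trans (le_trans ?_ (integral_abs_le_norm (X - Y)))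
  refine integral_mono_ae ?_ ?_ ?_
  · exact ((integrable_exp_mul_I (Lp.aestronglyMeasurable X)).sub
      (integrable_exp_mul_I (Lp.aestronglyMeasurable Y))).norm
  · exact ((Lp.memLp (X - Y)).integrable (by norm_num)).abs
  · filter_upwards [Lp.coeFn_sub X Y] with ω hω
    rw [hω]
    exact norm_exp_mul_I_sub_le _ _

lemma charVal_elemIntegral_add (hB : IsBrownianReal B P) (hW : IsBrownianReal W P)
    (hBW : IndepFun (fun ω t => B t ω) (fun ω t => W t ω) P) (c d : unitInterval →₀ ℝ) :
    charVal (elemIntegral hB c + elemIntegral hW d) =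
      Complex.exp (-((‖stepFun c‖ ^ 2 + ‖stepFun d‖ ^ 2 : ℝ) : ℂ) / 2) := by
  have := hB.isGaussianProcess.isProbabilityMeasure
  have h1 := hasLaw_elemSum hB c
  have h2 := hasLaw_elemSum hW d
  -- Each elementary sum is a measurable function of the whole path, so independence of the two
  -- processes passes to the sums.
  let φ : (unitInterval →₀ ℝ) → (ℝ≥0 → ℝ) → ℝ := fun c x =>
    ∑ t ∈ c.support, c t * x (unitInterval.toNNReal t)
  have hφ : ∀ c, Measurable (φ c) := fun c => by fun_prop
  have hind : IndepFun (fun ω => ∑ t ∈ c.support, c t • B (unitInterval.toNNReal t) ω)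
      (fun ω => ∑ t ∈ d.support, d t • W (unitInterval.toNNReal t) ω) P := hBW.comp (hφ c) (hφ d)
  have h3 := congrFun (hind.charFun_map_fun_add_eq_mul h1.aemeasurable h2.aemeasurable) 1
  rw [Pi.mul_apply, h1.map_eq, h2.map_eq, charFun_gaussianReal, charFun_gaussianReal, charFun_apply_real,
    integral_map (h1.aemeasurable.fun_add h2.aemeasurable) (by fun_prop), ← Complex.exp_add] at h3
  have h4 : charVal (elemIntegral hB c + elemIntegral hW d) =
      ∫ ω, Complex.exp (((1 : ℝ) : ℂ) * ((∑ t ∈ c.support, c t • B (unitInterval.toNNReal t) ω +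
        ∑ t ∈ d.support, d t • W (unitInterval.toNNReal t) ω : ℝ) : ℂ) * Complex.I) ∂P := by
    refine integral_congr_ae ?_
    filter_upwards [coeFn_elemIntegral hB c, coeFn_elemIntegral hW d,
      Lp.coeFn_add (elemIntegral hB c) (elemIntegral hW d)] with ω e1 e2 e3
    rw [e3, Pi.add_apply, e1, e2, Complex.ofReal_one, one_mul]
  rw [h4, h3]
  congr 1
  push_cast
  simp
  ring

lemma charVal_wienerIntegral_add (hB : IsBrownianReal B P) (hW : IsBrownianReal W P)
    (hBW : IndepFun (fun ω t => B t ω) (fun ω t => W t ω) P) (g f : L2I) :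
    charVal (wienerIntegral hB g + wienerIntegral hW f) =
      Complex.exp (-((‖g‖ ^ 2 + ‖f‖ ^ 2 : ℝ) : ℂ) / 2) := by
  have := hB.isGaussianProcess.isProbabilityMeasure
  have hc := continuous_charVal (P := P)
  refine denseRange_stepFun.induction_on₂ (p := fun g f => charVal (wienerIntegral hB g + wienerIntegral hW f) =
      Complex.exp (-((‖g‖ ^ 2 + ‖f‖ ^ 2 : ℝ) : ℂ) / 2)) (isClosed_eq ?_ ?_) (fun c d => ?_) g f
  · fun_prop
  · fun_prop
  · rw [wienerIntegral_stepFun, wienerIntegral_stepFun, charVal_elemIntegral_add hB hW hBW]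

/-- The observations as a linear map. -/
noncomputable def obsLinear (hB : IsBrownianReal B P) (hW : IsBrownianReal W P)
    (hσ : MemLp σ 2 (volume : Measure unitInterval)) (ε : ℝ) : L2I →ₗ[ℝ] Lp ℝ 2 P :=
  (wienerIntegral hB).toLinearMap ∘ₗ signalOp hσ + ε • (wienerIntegral hW).toLinearMap

lemma observation_eq_obsLinear (hB : IsBrownianReal B P) (hW : IsBrownianReal W P)
    (hσ : MemLp σ 2 (volume : Measure unitInterval)) (ε : ℝ) (f : L2I) :
    observation hB hW hσ ε f = obsLinear hB hW hσ ε f := by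
  rw [observation, integral_smul_signal_eq]; rfl

lemma charVal_obsLinear (hB : IsBrownianReal B P) (hW : IsBrownianReal W P)
    (hBW : IndepFun (fun ω t => B t ω) (fun ω t => W t ω) P)
    (hσ : MemLp σ 2 (volume : Measure unitInterval)) (ε : ℝ) (f : L2I) :
    charVal (obsLinear hB hW hσ ε f) = Complex.exp (-((‖obsOp hσ ε f‖ ^ 2 : ℝ) : ℂ) / 2) := by
  have h : obsLinear hB hW hσ ε f = wienerIntegral hB (signalOp hσ f) + wienerIntegral hW (ε • f) := by
    rw [map_smul]; rfl
  rw [h, charVal_wienerIntegral_add hB hW hBW, WithLp.prod_norm_sq_eq_of_L2]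
  rfl

/-- Observations along functions with orthogonal images are independent centred Gaussians. -/
lemma map_obsLinear_eq_pi (hB : IsBrownianReal B P) (hW : IsBrownianReal W P)
    (hBW : IndepFun (fun ω t => B t ω) (fun ω t => W t ω) P)
    (hσ : MemLp σ 2 (volume : Measure unitInterval)) (ε : ℝ) {ι : Type*} [Fintype ι] {e : ι → L2I}
    (he : ∀ i j, i ≠ j → inner ℝ (obsOp hσ ε (e i)) (obsOp hσ ε (e j)) = 0) :
    P.map (fun ω i => obsLinear hB hW hσ ε (e i) ω) =
      Measure.pi fun i => gaussianReal 0 (‖obsOp hσ ε (e i)‖₊ ^ 2) := by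
  classical
  have := hB.isGaussianProcess.isProbabilityMeasure
  have hm : Measurable (fun ω i => obsLinear hB hW hσ ε (e i) ω) :=
    measurable_pi_lambda _ fun i => (Lp.stronglyMeasurable _).measurable
  have := Measure.isProbabilityMeasure_map (μ := P) hm.aemeasurable
  refine charFun_eq_pi_iff.1 fun t => ?_
  rw [Measure.map_map (by fun_prop) hm, charFun_apply, integral_map (by fun_prop) (by fun_prop)]
  -- Cramér–Wold: pairing the vector with `t` is, by linearity, the single observation along `∑ tᵢ
  -- eᵢ`.
  have h1 : ∫ ω, Complex.exp ((inner ℝ ((WithLp.toLp 2 ∘ fun ω i => obsLinear hB hW hσ ε (e i) ω) ω) t : ℝ) * Complex.I) ∂P =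
      charVal (obsLinear hB hW hσ ε (∑ i, t.ofLp i • e i)) := by
    refine integral_congr_ae ?_
    simp only [map_sum, map_smul]
    filter_upwards [coeFn_lp_sum_smul Finset.univ t.ofLp fun i => obsLinear hB hW hσ ε (e i)] with ω hω
    rw [hω, PiLp.inner_apply]
    rfl
  have h2 : ‖obsOp hσ ε (∑ i, t.ofLp i • e i)‖ ^ 2 = ∑ i, t.ofLp i ^ 2 * ‖obsOp hσ ε (e i)‖ ^ 2 := by
    rw [← real_inner_self_eq_norm_sq]
    simp only [map_sum, map_smul, sum_inner, inner_sum, inner_smul_left, inner_smul_right]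
    refine Finset.sum_congr rfl fun i _ => ?_
    rw [Finset.sum_eq_single i]
    · rw [real_inner_self_eq_norm_sq]; simp; ring
    · intro j _ hj; rw [he _ _ hj]; simp
    · simp
  rw [h1, charVal_obsLinear hB hW hBW, h2]
  simp_rw [charFun_gaussianReal]
  rw [← Complex.exp_sum]
  congr 1
  push_cast
  rw [← Finset.sum_neg_distrib, Finset.sum_div]
  refine Finset.sum_congr rfl fun i _ => ?_
  simp
  ring

lemma measurable_obsLinear (hB : IsBrownianReal B P) (hW : IsBrownianReal W P)
    (hσ : MemLp σ 2 (volume : Measure unitInterval)) (ε : ℝ) {ι : Type*} (e : ι → L2I) :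
    Measurable (fun ω i => obsLinear hB hW hσ ε (e i) ω) :=
  measurable_pi_lambda _ fun _ => (Lp.stronglyMeasurable _).measurable

/-- The law of the observations on a cylinder set, through finitely many observations that span
the relevant ones. -/
lemma observationLaw_cylinder (hB : IsBrownianReal B P) (hW : IsBrownianReal W P)
    (hσ : MemLp σ 2 (volume : Measure unitInterval)) (ε : ℝ) {ι : Type*} [Fintype ι] (e : ι → L2I)
    (s : Finset L2I) {c : s → ι → ℝ} (hc : ∀ f : s, (f : L2I) = ∑ i, c f i • e i)
    {S : Set (s → ℝ)} (hS : MeasurableSet S) :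
    (observationLaw hB hW hσ ε).real (cylinder s S) =
      (P.map (fun ω i => obsLinear hB hW hσ ε (e i) ω)).real
        ((fun (x : ι → ℝ) (f : s) => ∑ i, c f i * x i) ⁻¹' S) := by
  have hL : Measurable (fun (x : ι → ℝ) (f : s) => ∑ i, c f i * x i) := by fun_prop
  rw [observationLaw, map_measureReal_apply (measurable_observation hB hW hσ ε) (MeasurableSet.cylinder s hS),
    map_measureReal_apply (measurable_obsLinear hB hW hσ ε e) (hL hS)]
  refine measureReal_congr ?_
  -- Linearity in `f` holds only almost surely for each `f`; finiteness of `s` leaves one null set.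
  have h : ∀ᵐ ω ∂P, ∀ f : s, observation hB hW hσ ε f ω = ∑ i, c f i * obsLinear hB hW hσ ε (e i) ω := by
    rw [ae_all_iff]
    intro f
    have h1 : observation hB hW hσ ε f = ∑ i, c f i • obsLinear hB hW hσ ε (e i) := by
      rw [observation_eq_obsLinear]
      conv_lhs => rw [hc f]
      simp only [map_sum, map_smul]
    rw [h1]
    exact coeFn_lp_sum_smul _ _ _
  filter_upwards [h] with ω hω
  have h2 : (s.restrict fun f => observation hB hW hσ ε f ω) =
      fun f : s => ∑ i, c f i * obsLinear hB hW hσ ε (e i) ω := funext hω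
  exact propext (by
    change s.restrict (fun f => observation hB hW hσ ε f ω) ∈ S ↔ _
    rw [h2]; rfl)

/-! ### Total variation distance of the observation laws -/

lemma abs_observationLaw_sub_le (hB : IsBrownianReal B P) (hW : IsBrownianReal W P)
    (hBW : IndepFun (fun ω t => B t ω) (fun ω t => W t ω) P) {σ₁ σ₂ : unitInterval → ℝ}
    (hσ₁ : MemLp σ₁ 2 (volume : Measure unitInterval)) (hσ₂ : MemLp σ₂ 2 (volume : Measure unitInterval))
    {b ε δ : ℝ} (hb0 : 0 < b) (hε : 0 < ε) (hb : ∀ s, b ≤ σ₁ s ^ 2)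
    (hδ : ∀ s, |σ₂ s ^ 2 - σ₁ s ^ 2| ≤ δ) {A : Set (L2I → ℝ)} (hA : MeasurableSet A) :
    |(observationLaw hB hW hσ₁ ε).real A - (observationLaw hB hW hσ₂ ε).real A| ≤
      √(2 * (δ ^ 2 * (b⁻¹ * (√b * ε)⁻¹))) := by
  have := isProbabilityMeasure_observationLaw hB hW hσ₁ ε
  have := isProbabilityMeasure_observationLaw hB hW hσ₂ ε
  refine abs_measureReal_sub_le_of_measurableCylinders _ _ (fun A hA => ?_) hA
  obtain ⟨s, S, hS, rfl⟩ := (mem_measurableCylinders A).1 hA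
  obtain ⟨n, e, hspan, he, ho⟩ :=
    exists_orthonormal_orthogonal (obsOp hσ₁ ε) (obsOp hσ₂ ε) (injective_obsOp hσ₁ hε) s
  have hc : ∀ f : s, ∃ c : Fin n → ℝ, (f : L2I) = ∑ i, c i • e i := fun f => by
    obtain ⟨c, hc⟩ := (Submodule.mem_span_range_iff_exists_fun ℝ).1 (hspan f f.2)
    exact ⟨c, hc.symm⟩
  choose c hc using hc
  have hL : Measurable (fun (x : Fin n → ℝ) (f : s) => ∑ i, c f i * x i) := by fun_prop
  rw [observationLaw_cylinder hB hW hσ₁ ε e s hc hS, observationLaw_cylinder hB hW hσ₂ ε e s hc hS,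
    map_obsLinear_eq_pi hB hW hBW hσ₁ ε fun i j hij => he.2 hij, map_obsLinear_eq_pi hB hW hBW hσ₂ ε ho]
  have h1 : (fun i => gaussianReal 0 (‖obsOp hσ₁ ε (e i)‖₊ ^ 2)) = fun _ : Fin n => gaussianReal 0 1 := by
    funext i
    congr 1
    ext; simp [he.1 i]
  rw [h1]
  refine (abs_pi_gaussianReal_sub_le _ (hL hS)).trans (Real.sqrt_le_sqrt ?_)
  have h2 := sum_norm_obsOp_sq_sub_one_sq_le hσ₁ hσ₂ hb0 hε hb hδ he
  push_cast
  linarith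

/-! ### Approximation by piecewise constant volatilities -/

lemma abs_sub_le_of_mem_volClass {α R b : ℝ} (hα : 0 < α) (hR : 0 ≤ R) {v : unitInterval → ℝ}
    (hv : v ∈ volClass α R b) (x y : unitInterval) : |v x - v y| ≤ R * |(x : ℝ) - y| ^ α := by
  rcases eq_or_ne x y with rfl | hxy
  · simp [Real.zero_rpow hα.ne']
  have h1 : ENNReal.ofReal (|v x - v y| / |(x : ℝ) - y| ^ α) ≤ ENNReal.ofReal R :=
    (le_iSup₂_of_le (f := fun x y : unitInterval => ⨆ (_ : x ≠ y),
      ENNReal.ofReal (|v x - v y| / |(x : ℝ) - y| ^ α)) x y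
        (le_iSup_of_le hxy le_rfl)).trans (le_add_self.trans hv.1)
  have hpos : 0 < |(x : ℝ) - y| ^ α :=
    Real.rpow_pos_of_pos (abs_pos.2 (sub_ne_zero.2 fun e => hxy (Subtype.ext e))) _
  exact (div_le_iff₀ hpos).1 ((ENNReal.ofReal_le_ofReal_iff hR).1 h1)

lemma abs_blockFloor_sub_le {h : ℝ} (hh : 0 < h) (s : unitInterval) : |(blockFloor h s : ℝ) - s| ≤ h := by
  rw [coe_blockFloor hh, abs_le]
  have h1 := mul_le_mul_of_nonneg_right (Int.floor_le ((s : ℝ) / h)) hh.le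
  have h2 := mul_le_mul_of_nonneg_right (Int.lt_floor_add_one ((s : ℝ) / h)).le hh.le
  rw [div_mul_cancel₀ _ hh.ne'] at h1 h2
  constructor <;> nlinarith

lemma tvDist_le {α R b : ℝ} (hα : 0 < α) (hR : 0 < R) (hb : 0 < b) (hB : IsBrownianReal B P)
    (hW : IsBrownianReal W P) (hBW : IndepFun (fun ω t => B t ω) (fun ω t => W t ω) P) {ε h : ℝ}
    (hε : 0 < ε) (hh : 0 < h) (v : volClass α R b) :
    tvDist ((experimentOne hB hW ε hα hR b).law v) ((experimentTwo hB hW ε h hα hR b).law v) ≤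
      ENNReal.ofReal (√2 * (R * (√b) ^ (-(3 / 2) : ℝ) * h ^ α * ε ^ (-(1 / 2) : ℝ))) := by
  have hv2 : ∀ s, √(v.1 s) ^ 2 = v.1 s := fun s => Real.sq_sqrt (hb.le.trans (v.2.2 s))
  refine iSup₂_le fun A hA => ENNReal.ofReal_le_ofReal ?_
  refine (abs_observationLaw_sub_le hB hW hBW (memLp_vol hα hR.le v.2) (memLp_blockVol hα hR.le h v.2)
    hb hε (fun s => by rw [vol, hv2]; exact v.2.2 s) (δ := R * h ^ α) (fun s => ?_) hA).trans_eq ?_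
  · rw [blockVol, vol, vol, hv2, hv2]
    refine (abs_sub_le_of_mem_volClass hα hR.le v.2 _ _).trans ?_
    gcongr
    exact abs_blockFloor_sub_le hh s
  · have hsb : 0 < √b := Real.sqrt_pos.2 hb
    rw [Real.sqrt_eq_iff_mul_self_eq (by positivity) (by positivity)]
    have e1 : ((√b) ^ (-(3 / 2) : ℝ)) ^ 2 = b⁻¹ * (√b)⁻¹ := by
      rw [← Real.rpow_natCast, ← Real.rpow_mul hsb.le, show (-(3 / 2) : ℝ) * ((2 : ℕ) : ℝ) = -((3 : ℕ) : ℝ) by norm_num,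
        Real.rpow_neg hsb.le, Real.rpow_natCast, ← mul_inv]
      congr 1
      rw [pow_succ, Real.sq_sqrt hb.le]
    have e2 : (ε ^ (-(1 / 2) : ℝ)) ^ 2 = ε⁻¹ := by
      rw [← Real.rpow_natCast, ← Real.rpow_mul hε.le, show (-(1 / 2) : ℝ) * ((2 : ℕ) : ℝ) = -1 by norm_num,
        Real.rpow_neg_one]
    have e3 : √2 ^ 2 = (2 : ℝ) := Real.sq_sqrt zero_le_two
    have e4 : (√2 * (R * (√b) ^ (-(3 / 2) : ℝ) * h ^ α * ε ^ (-(1 / 2) : ℝ))) ^ 2 =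
        √2 ^ 2 * (R ^ 2 * ((√b) ^ (-(3 / 2) : ℝ)) ^ 2 * (h ^ α) ^ 2 * (ε ^ (-(1 / 2) : ℝ)) ^ 2) := by ring
    rw [← sq, e4, e1, e2, e3, mul_inv]
    ring

end Volatility

/-! ### Le Cam distance on a common sample space -/

namespace LeCam

lemma tvDist_comm {𝒳 : Type*} [MeasurableSpace 𝒳] (μ ν : Measure 𝒳) : tvDist μ ν = tvDist ν μ := by
  simp only [tvDist, abs_sub_comm]

/-- Two experiments on the same sample space are compared through the identity kernel. -/
lemma leCamDist_le_of_tvDist_le {Θ X : Type*} [MeasurableSpace X] {p q : Θ → Measure X}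
    (hp : ∀ θ, IsProbabilityMeasure (p θ)) (hq : ∀ θ, IsProbabilityMeasure (q θ)) {c : ℝ≥0∞}
    (h : ∀ θ, tvDist (p θ) (q θ) ≤ c) : leCamDist ⟨X, p, hp⟩ ⟨X, q, hq⟩ ≤ c := by
  refine max_le ?_ ?_
  · refine iInf₂_le_of_le (Kernel.id : Kernel X X) inferInstance (iSup_le fun θ => ?_)
    rw [Measure.id_comp]
    exact h θ
  · refine iInf₂_le_of_le (Kernel.id : Kernel X X) inferInstance (iSup_le fun θ => ?_)
    rw [Measure.id_comp, tvDist_comm]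
    exact h θ

end LeCam

/-! ### The proposition -/

theorem proposition3p2 :
    ∃ C : ℝ, 0 < C ∧
      ∀ (Ω : Type*) [MeasurableSpace Ω] (P : Measure Ω) (B W : ℝ≥0 → Ω → ℝ)
        (hB : IsBrownianReal B P) (hW : IsBrownianReal W P)
        (_ : IndepFun (fun ω t => B t ω) (fun ω t => W t ω) P)
        (α R b : ℝ) (hα : 1 / 2 < α) (_ : α ≤ 1) (hR : 0 < R) (_ : 0 < b),
        -- asymptotic equivalence as `ε → 0` and `h ^ α = o(ε ^ (1 / 2))`
        (∀ (ι : Type*) (l : Filter ι) (ε h : ι → ℝ) (_ : ∀ i, 0 < ε i)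
          (_ : ∀ i, Volatility.IsBlockLength (h i)) (_ : Tendsto ε l (𝓝 0))
          (_ : (fun i => h i ^ α) =o[l] (fun i => ε i ^ (1 / 2 : ℝ))),
          LeCam.AsymptoticallyEquivalent l
            (fun i => Volatility.experimentOne hB hW (ε i) (one_half_pos.trans hα) hR b)
            (fun i => Volatility.experimentTwo hB hW (ε i) (h i) (one_half_pos.trans hα) hR b)) ∧
        -- the explicit bound, with the universal constant `C`
        (∀ (ε h : ℝ) (_ : 0 < ε) (_ : Volatility.IsBlockLength h),
          LeCam.leCamDist
              (Volatility.experimentOne hB hW ε (one_half_pos.trans hα) hR b)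
              (Volatility.experimentTwo hB hW ε h (one_half_pos.trans hα) hR b) ≤
            ENNReal.ofReal
              (C * (R * (√b) ^ (-(3 / 2) : ℝ) * h ^ α * ε ^ (-(1 / 2) : ℝ)))) := by
  refine ⟨√2, by positivity, ?_⟩
  intro Ω _ P B W hB hW hBW α R b hα _ hR hb
  have key : ∀ (ε h : ℝ) (_ : 0 < ε) (_ : Volatility.IsBlockLength h),
      LeCam.leCamDist
          (Volatility.experimentOne hB hW ε (one_half_pos.trans hα) hR b)
          (Volatility.experimentTwo hB hW ε h (one_half_pos.trans hα) hR b) ≤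
        ENNReal.ofReal (√2 * (R * (√b) ^ (-(3 / 2) : ℝ) * h ^ α * ε ^ (-(1 / 2) : ℝ))) :=
    fun ε h hε hh => LeCam.leCamDist_le_of_tvDist_le _ _ fun v =>
      Volatility.tvDist_le (one_half_pos.trans hα) hR hb hB hW hBW hε hh.1 v
  refine ⟨fun ι l ε h hε hh _ ho => ?_, key⟩
  refine tendsto_of_tendsto_of_tendsto_of_le_of_le tendsto_const_nhds ?_ (fun _ => zero_le) fun i => key (ε i) (h i) (hε i) (hh i)
  rw [← ENNReal.ofReal_zero]
  refine ENNReal.tendsto_ofReal ?_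
  -- The explicit bound is a constant times `h^α / ε^(1/2)`, which vanishes by the little-o
  -- hypothesis.
  have h1 := (ho.tendsto_div_nhds_zero).const_mul (√2 * (R * (√b) ^ (-(3 / 2) : ℝ)))
  rw [mul_zero] at h1
  refine h1.congr fun i => ?_
  rw [Real.rpow_neg (hε i).le]
  ring
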